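/- Let $p\in\{1,2,3\}$ and let $L^2=L^2(0,2\pi)$ be the real Lebesgue space with its usual norm $\|\cdot\|$. Let $$(A^{(p)}\varphi)(x)=\frac1{(p-1)!}\int_0^x (x-t)^{p-1}\varphi(t)\,dt,\qquad \varphi\in L^2,\ x\in(0,2\pi).$$ For $n\ge 0$ let $X_n\subset L^2$ be the span of the constant function $\frac1{\sqrt{2\pi}}$ and of $\frac{\cos kt}{\sqrt\pi},\frac{\sin kt}{\sqrt\pi}$ $(1\le k\le n)$, let $P_n$ be the orthogonal projection of $L^2$ onto $X_n$, and let $A_n^{(p)}=P_nA^{(p)}P_n:X_n\to X_n$. For a bounded linear operator $A$ between real Hilbert spaces, $A^\dagger y$ denotes the element of smallest norm among the minimizers of $x\mapsto\|Ax-y\|$ (Moore–Penrose inverse). Put $\gamma^{(p)}=1+\kappa^{(p)}$ and $\kappa^{(p)}=\big(\sum_{i=1}^6 (C_i^{(p)})^2\big)^{1/2}$, where $$(C_i^{(1)})_{i=1}^6=\Big(0,0,0,\tfrac{\sqrt2}{\pi},\tfrac2\pi,0\Big),\quad (C_i^{(2)})_{i=1}^6=\Big(\sqrt2,2,\pi,\tfrac{3\sqrt2}2,3,5\Big),\quad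 (C_i^{(3)})_{i=1}^6=\Big(11\sqrt2,23,11\pi,\tfrac{44\sqrt2}3,30,48\Big).$$ Let $H^p(0,2\pi)$ be the space of $y\in L^2$ whose weak derivatives of orders $1,\dots,p$ exist and lie in $L^2$. Every such $y$ is identified with its representative in $C^{p-1}[0,2\pi]$ whose derivative of order $p-1$ is a constant plus the integral $\int_0^x\Psi(t)\,dt$ of some $\Psi\in L^2$. Let $\mathcal H_0^p(0,2\pi)=\{y\in H^p(0,2\pi): y(0)=\dots=y^{(p-1)}(0)=0\}$, and write $y^{(p)}\in L^2$ for the weak derivative of order $p$. For real $l>0$ let $H^l_{per}(0,2\pi)$ be the space of $\varphi\in L^2$ with $$\|\varphi\|_{H^l_{per}}^2=\xi_0^2+\sum_{k=1}^\infty(1+k^2)^l(\xi_k^2+\eta_k^2)<\infty,$$ where $\xi_0=\frac1{\sqrt{2\pi}}\int_0^{2\pi}\varphi(t)\,dt$, $\xi_k=\frac1{\sqrt\pi}\int_0^{2\pi}\varphi(t)\cos kt\,dt$ and $\eta_k=\frac1{\sqrt\pi}\int_0^{2\pi}\varphi(t)\sin kt\,dt$. **Corollary 5.1.** For every $y\in\mathcal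 H_0^p(0,2\pi)$ and every integer $n\ge1$, $$\|A_n^{(p)\dagger}P_ny-y^{(p)}\|\le(\gamma^{(p)}+1)\,\|(I-P_n)y^{(p)}\|.$$ The right-hand side, and hence the left-hand side, tends to $0$ as $n\to\infty$. If in addition $y^{(p)}\in H^l_{per}(0,2\pi)$ for some real $l>0$, then for every integer $n\ge1$ $$\|A_n^{(p)\dagger}P_ny-y^{(p)}\|\le\frac{\gamma^{(p)}+1}{n^l}\,\|y^{(p)}\|_{H^l_{per}}.$$ -/

import Mathlib

open MeasureTheory Set Filter Topology
open scoped ContDiff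

noncomputable section

namespace TrigGalerkin

/-! ### The Moore-Penrose inverse -/

section MoorePenrose

variable {X Y : Type*} [NormedAddCommGroup X] [InnerProductSpace ℝ X]
  [NormedAddCommGroup Y] [InnerProductSpace ℝ Y]

/-- `x` minimizes the residual `‖A x - y‖`. -/
def IsLeastSquares (A : X →L[ℝ] Y) (y : Y) (x : X) : Prop :=
  ∀ z : X, ‖A x - y‖ ≤ ‖A z - y‖

/-- `x` is an element of smallest norm among the minimizers of the residual `‖A x - y‖`. -/
def IsMinNormLeastSquares (A : X →L[ℝ] Y) (y : Y) (x : X) : Prop :=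
  IsLeastSquares A y x ∧ ∀ z : X, IsLeastSquares A y z → ‖x‖ ≤ ‖z‖

open Classical in
/-- The Moore-Penrose inverse `A† y`: the least-squares solution of smallest norm of `A x = y`
(with the value `0` when there is no such element). -/
def moorePenrose (A : X →L[ℝ] Y) (y : Y) : X :=
  if h : ∃ x, IsMinNormLeastSquares A y x then h.choose else 0

/-- In finite dimension the least-squares solution of smallest norm exists. -/
theorem exists_isMinNormLeastSquares [FiniteDimensional ℝ X] (A : X →L[ℝ] Y) (y : Y) :
    ∃ x, IsMinNormLeastSquares A y x := by
  have hfin : FiniteDimensional ℝ (LinearMap.range (A : X →ₗ[ℝ] Y)) := inferInstance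
  obtain ⟨x₀, hx₀⟩ := ((LinearMap.range (A : X →ₗ[ℝ] Y)).starProjection_apply_mem y)
  have hls : ∀ x, A x = A x₀ → IsLeastSquares A y x := by
    intro x hx z
    have h1 := (LinearMap.range (A : X →ₗ[ℝ] Y)).starProjection_minimal y
    have h0 : A x₀ = (LinearMap.range (A : X →ₗ[ℝ] Y)).starProjection y := hx₀
    rw [hx, h0, norm_sub_rev, norm_sub_rev (A z), h1]
    exact ciInf_le ⟨0, by rintro _ ⟨w, rfl⟩; exact norm_nonneg _⟩
      (⟨A z, ⟨z, rfl⟩⟩ : LinearMap.range (A : X →ₗ[ℝ] Y))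
  have hconv : IsClosed {x | IsLeastSquares A y x} := by
    simp only [IsLeastSquares, ofPred_forall]
    exact isClosed_iInter fun z => isClosed_le (by fun_prop) (by fun_prop)
  have : ProperSpace X := FiniteDimensional.proper_real X
  obtain ⟨x, hx, hmin⟩ := hconv.exists_infDist_eq_dist ⟨x₀, hls x₀ rfl⟩ 0
  refine ⟨x, hx, fun z hz => ?_⟩
  have := Metric.infDist_le_dist_of_mem (x := (0 : X)) (s := {x | IsLeastSquares A y x}) hz
  rw [hmin] at this
  simpa using this

/-- The least-squares solution of smallest norm is unique. -/
theorem IsMinNormLeastSquares.unique {A : X →L[ℝ] Y} {y : Y} {x z : X}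
    (hx : IsMinNormLeastSquares A y x) (hz : IsMinNormLeastSquares A y z) : x = z := by
  have hmid : IsLeastSquares A y ((1 / 2 : ℝ) • (x + z)) := by
    intro w
    have e : A ((1 / 2 : ℝ) • (x + z)) - y
        = (1 / 2 : ℝ) • (A x - y) + (1 / 2 : ℝ) • (A z - y) := by
      rw [map_smul, map_add]
      module
    rw [e]
    refine (norm_add_le _ _).trans ?_
    rw [norm_smul, norm_smul]
    have h1 := hx.1 w
    have h2 := hz.1 w
    norm_num
    linarith
  have h1 := hx.2 _ hmid
  have h2 := hz.2 _ hx.1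
  have h3 := hx.2 _ hz.1
  rw [norm_smul] at h1
  norm_num at h1
  have h4 := parallelogram_law_with_norm ℝ x z
  have h5 : ‖x‖ = ‖z‖ := le_antisymm h3 h2
  have h6 : ‖x - z‖ * ‖x - z‖ ≤ 0 := by
    nlinarith [norm_nonneg x, norm_nonneg (x + z)]
  have h7 : ‖x - z‖ = 0 := by nlinarith [norm_nonneg (x - z)]
  exact sub_eq_zero.mp (norm_eq_zero.mp h7)

/-- In finite dimension `moorePenrose A y` is the least-squares solution of smallest norm. -/
theorem moorePenrose_spec [FiniteDimensional ℝ X] (A : X →L[ℝ] Y) (y : Y) :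
    IsMinNormLeastSquares A y (moorePenrose A y) := by
  have h := exists_isMinNormLeastSquares A y
  rw [moorePenrose, dif_pos h]
  exact h.choose_spec

end MoorePenrose

/-! ### The space `L²(0, 2π)` and the trigonometric subspaces -/

/-- Lebesgue measure on `(0, 2π)`. -/
abbrev mu : Measure ℝ := volume.restrict (Ioo 0 (2 * Real.pi))

/-- The real Hilbert space `L²(0, 2π)`. -/
abbrev L2 : Type := Lp ℝ 2 mu

theorem memLp_constE : MemLp (fun _ : ℝ => 1 / √(2 * Real.pi)) 2 mu :=
  MeasureTheory.memLp_const _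

theorem memLp_cos (k : ℕ) : MemLp (fun t : ℝ => Real.cos (k * t) / √Real.pi) 2 mu := by
  refine MemLp.of_bound (by fun_prop) (1 / √Real.pi) (Eventually.of_forall fun t => ?_)
  rw [norm_div, Real.norm_of_nonneg (Real.sqrt_nonneg Real.pi)]
  exact div_le_div_of_nonneg_right (Real.abs_cos_le_one _) (Real.sqrt_nonneg _)

theorem memLp_sin (k : ℕ) : MemLp (fun t : ℝ => Real.sin (k * t) / √Real.pi) 2 mu := by
  refine MemLp.of_bound (by fun_prop) (1 / √Real.pi) (Eventually.of_forall fun t => ?_)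
  rw [norm_div, Real.norm_of_nonneg (Real.sqrt_nonneg Real.pi)]
  exact div_le_div_of_nonneg_right (Real.abs_sin_le_one _) (Real.sqrt_nonneg _)

/-- The constant function `1 / √(2π)` in `L²(0, 2π)`. -/
def constE : L2 := memLp_constE.toLp _

/-- The function `cos (k t) / √π` in `L²(0, 2π)`. -/
def cosE (k : ℕ) : L2 := (memLp_cos k).toLp _

/-- The function `sin (k t) / √π` in `L²(0, 2π)`. -/
def sinE (k : ℕ) : L2 := (memLp_sin k).toLp _

/-- The space `X_n` of trigonometric polynomials of degree at most `n`. -/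
def trigSpace (n : ℕ) : Submodule ℝ L2 :=
  Submodule.span ℝ ({constE} ∪ cosE '' Icc 1 n ∪ sinE '' Icc 1 n)

instance (n : ℕ) : FiniteDimensional ℝ (trigSpace n) :=
  FiniteDimensional.span_of_finite ℝ
    (((finite_singleton _).union ((finite_Icc 1 n).image _)).union ((finite_Icc 1 n).image _))

/-- The orthogonal projection `P_n` of `L²(0, 2π)` onto `X_n`, with values in `X_n`. -/
def projTo (n : ℕ) : L2 →L[ℝ] trigSpace n := (trigSpace n).orthogonalProjectionOnto

/-- The orthogonal projection `P_n` of `L²(0, 2π)` onto `X_n`, as an operator on `L²(0, 2π)`. -/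
def proj (n : ℕ) : L2 →L[ℝ] L2 := (trigSpace n).subtypeL ∘L projTo n

/-! ### The integral operator `A^(p)` and its Galerkin approximation -/

/-- The function `x ↦ 1/(p-1)! ∫₀ˣ (x-t)^(p-1) φ(t) dt`. -/
def volterraFun (p : ℕ) (φ : ℝ → ℝ) (x : ℝ) : ℝ :=
  1 / ((p - 1).factorial : ℝ) * ∫ t in (0 : ℝ)..x, (x - t) ^ (p - 1) * φ t

theorem integrable_L2 (φ : L2) : Integrable φ mu :=
  (Lp.memLp φ).integrable (by norm_num)

theorem intervalIntegrable_L2 (φ : L2) {x : ℝ} (hx : x ∈ Ioo 0 (2 * Real.pi)) :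
    IntervalIntegrable φ volume 0 x := by
  rw [intervalIntegrable_iff_integrableOn_Ioc_of_le hx.1.le]
  exact IntegrableOn.mono_set (integrable_L2 φ) fun t ht => ⟨ht.1, ht.2.trans_lt hx.2⟩

theorem intervalIntegrable_kernel (p : ℕ) (φ : L2) {x : ℝ} (hx : x ∈ Ioo 0 (2 * Real.pi)) :
    IntervalIntegrable (fun t => (x - t) ^ (p - 1) * φ t) volume 0 x :=
  (intervalIntegrable_L2 φ hx).continuousOn_mul (by fun_prop)

theorem memLp_volterraFun (p : ℕ) (φ : L2) : MemLp (volterraFun p φ) 2 mu := by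
  have hmeas : AEStronglyMeasurable
      (fun x => ∫ t, (Iio x).indicator (fun t => (x - t) ^ (p - 1) * φ t) t ∂mu) mu := by
    have h1 : StronglyMeasurable (fun q : ℝ × ℝ =>
        {q : ℝ × ℝ | q.2 < q.1}.indicator (fun q => (q.1 - q.2) ^ (p - 1) * φ q.2) q) := by
      refine StronglyMeasurable.indicator ?_ (measurableSet_lt measurable_snd measurable_fst)
      refine StronglyMeasurable.mul (by fun_prop) ?_
      exact (Lp.stronglyMeasurable φ).comp_measurable measurable_snd
    exact (h1.integral_prod_right (ν := mu)).aestronglyMeasurable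
  have heq : ∀ x ∈ Ioo 0 (2 * Real.pi), volterraFun p φ x = 1 / ((p - 1).factorial : ℝ) *
      ∫ t, (Iio x).indicator (fun t => (x - t) ^ (p - 1) * φ t) t ∂mu := by
    intro x hx
    rw [volterraFun, intervalIntegral.integral_of_le hx.1.le,
      integral_indicator measurableSet_Iio, Measure.restrict_restrict measurableSet_Iio,
      ← integral_Ioc_eq_integral_Ioo.symm]
    congr 2
    congr 1
    ext t
    simp only [mem_Ioo, mem_inter_iff, mem_Iio]
    constructor
    · rintro ⟨h1, h2⟩
      exact ⟨h2, h1, h2.trans hx.2⟩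
    · rintro ⟨h1, h2, h3⟩
      exact ⟨h2, h1⟩
  have hmeas' : AEStronglyMeasurable (volterraFun p φ) mu := by
    refine (hmeas.const_mul (1 / ((p - 1).factorial : ℝ))).congr ?_
    filter_upwards [ae_restrict_mem measurableSet_Ioo] with x hx
    exact (heq x hx).symm
  refine MemLp.of_bound hmeas' (1 / ((p - 1).factorial : ℝ) *
    ∫ t, (2 * Real.pi) ^ (p - 1) * ‖φ t‖ ∂mu) ?_
  filter_upwards [ae_restrict_mem measurableSet_Ioo] with x hx
  rw [heq x hx, norm_mul, Real.norm_of_nonneg (by positivity : (0 : ℝ) ≤ 1 / _)]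
  refine mul_le_mul_of_nonneg_left ?_ (by positivity)
  refine norm_integral_le_of_norm_le ((integrable_L2 φ).norm.const_mul _) ?_
  filter_upwards [ae_restrict_mem measurableSet_Ioo] with t ht
  by_cases h : t < x
  · rw [indicator_of_mem (by exact h), norm_mul, norm_pow]
    gcongr
    rw [Real.norm_of_nonneg (by linarith)]
    linarith [ht.1, hx.2]
  · rw [indicator_of_notMem (by exact h), norm_zero]
    have := Real.pi_pos
    positivity

/-- The integral operator `A^(p)` on `L²(0, 2π)`, as a linear map. -/
def volterraLin (p : ℕ) : L2 →ₗ[ℝ] L2 where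
  toFun φ := (memLp_volterraFun p φ).toLp _
  map_add' φ ψ := by
    rw [← MemLp.toLp_add, MemLp.toLp_eq_toLp_iff]
    filter_upwards [ae_restrict_mem measurableSet_Ioo] with x hx
    have h : (∫ t in (0 : ℝ)..x, (x - t) ^ (p - 1) * (φ + ψ : L2) t) =
        ∫ t in (0 : ℝ)..x, ((x - t) ^ (p - 1) * φ t + (x - t) ^ (p - 1) * ψ t) := by
      refine intervalIntegral.integral_congr_ae_restrict ?_
      rw [uIoc_of_le hx.1.le]
      refine ae_restrict_of_ae_restrict_of_subset
        (fun t ht => ⟨ht.1, ht.2.trans_lt hx.2⟩ : Ioc 0 x ⊆ Ioo 0 (2 * Real.pi)) ?_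
      filter_upwards [Lp.coeFn_add φ ψ] with t ht
      rw [ht, Pi.add_apply, mul_add]
    rw [Pi.add_apply, volterraFun, volterraFun, volterraFun, h, intervalIntegral.integral_add
      (intervalIntegrable_kernel p φ hx) (intervalIntegrable_kernel p ψ hx), mul_add]
  map_smul' c φ := by
    rw [RingHom.id_apply, ← MemLp.toLp_const_smul, MemLp.toLp_eq_toLp_iff]
    filter_upwards [ae_restrict_mem measurableSet_Ioo] with x hx
    have h : (∫ t in (0 : ℝ)..x, (x - t) ^ (p - 1) * (c • φ : L2) t) =
        ∫ t in (0 : ℝ)..x, c * ((x - t) ^ (p - 1) * φ t) := by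
      refine intervalIntegral.integral_congr_ae_restrict ?_
      rw [uIoc_of_le hx.1.le]
      refine ae_restrict_of_ae_restrict_of_subset
        (fun t ht => ⟨ht.1, ht.2.trans_lt hx.2⟩ : Ioc 0 x ⊆ Ioo 0 (2 * Real.pi)) ?_
      filter_upwards [Lp.coeFn_smul c φ] with t ht
      rw [ht, Pi.smul_apply, smul_eq_mul]
      ring
    rw [Pi.smul_apply, smul_eq_mul, volterraFun, volterraFun, h,
      intervalIntegral.integral_const_mul]
    ring

/-- The Galerkin operator `A_n^(p) = P_n A^(p) P_n : X_n → X_n`. (On the finite-dimensional space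
`X_n` every linear map is continuous.) -/
def galerkinOp (p n : ℕ) : trigSpace n →L[ℝ] trigSpace n :=
  LinearMap.toContinuousLinearMap
    ((projTo n : L2 →ₗ[ℝ] trigSpace n) ∘ₗ volterraLin p ∘ₗ (proj n : L2 →ₗ[ℝ] L2) ∘ₗ
      (trigSpace n).subtype)

/-- The Galerkin approximation `A_n^(p)† P_n y`, viewed in `L²(0, 2π)`. -/
def galerkinApprox (p n : ℕ) (y : L2) : L2 :=
  (moorePenrose (galerkinOp p n) (projTo n y) : trigSpace n)

/-! ### Sobolev spaces -/

/-- `ζ` is the weak derivative of order `k` of `y` on `(0, 2π)`. -/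
def HasWeakDeriv (k : ℕ) (y ζ : L2) : Prop :=
  ∀ φ : ℝ → ℝ, ContDiff ℝ ∞ φ → HasCompactSupport φ → tsupport φ ⊆ Ioo 0 (2 * Real.pi) →
    ∫ x in Ioo 0 (2 * Real.pi), ζ x * φ x =
      (-1) ^ k * ∫ x in Ioo 0 (2 * Real.pi), y x * iteratedDeriv k φ x

/-- Membership in `H^p(0, 2π)`. -/
def MemH (p : ℕ) (y : L2) : Prop :=
  ∀ k ∈ Icc 1 p, ∃ ζ : L2, HasWeakDeriv k y ζ

/-- `f ∈ U^p[0, 2π]`: `f` is of class `C^(p-1)` on `[0, 2π]`, and its derivative of order `p - 1`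
is, up to a constant, the integral of a square integrable function. -/
def MemU (p : ℕ) (f : ℝ → ℝ) : Prop :=
  ContDiffOn ℝ (p - 1 : ℕ) f (Icc 0 (2 * Real.pi)) ∧
    ∃ (Ψ : L2) (α : ℝ), ∀ x ∈ Icc 0 (2 * Real.pi),
      iteratedDerivWithin (p - 1) f (Icc 0 (2 * Real.pi)) x = α + ∫ t in (0 : ℝ)..x, Ψ t

/-- Membership in `{y ∈ H^p(0, 2π) : y(0) = ⋯ = y^(p-1)(0) = 0}`, the initial values being those
of the representative of `y` in `U^p[0, 2π]`. -/
def MemH0 (p : ℕ) (y : L2) : Prop :=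
  MemH p y ∧ ∃ f : ℝ → ℝ, MemU p f ∧ y =ᵐ[mu] f ∧
    ∀ k < p, iteratedDerivWithin k f (Icc 0 (2 * Real.pi)) 0 = 0

/-- The Fourier coefficient `ξ_0`. -/
def fourierConst (φ : L2) : ℝ :=
  1 / √(2 * Real.pi) * ∫ t in Ioo 0 (2 * Real.pi), φ t

/-- The Fourier coefficient `ξ_k`. -/
def fourierCos (k : ℕ) (φ : L2) : ℝ :=
  1 / √Real.pi * ∫ t in Ioo 0 (2 * Real.pi), φ t * Real.cos (k * t)

/-- The Fourier coefficient `η_k`. -/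
def fourierSin (k : ℕ) (φ : L2) : ℝ :=
  1 / √Real.pi * ∫ t in Ioo 0 (2 * Real.pi), φ t * Real.sin (k * t)

/-- The `k`-th term, `k = 1, 2, …` written as `j + 1`, of the squared periodic Sobolev norm. -/
def hperTerm (s : ℝ) (φ : L2) (j : ℕ) : ℝ :=
  (1 + ((j + 1 : ℕ) : ℝ) ^ 2) ^ s * (fourierCos (j + 1) φ ^ 2 + fourierSin (j + 1) φ ^ 2)

/-- Membership in the periodic Sobolev space `H^s_per(0, 2π)`. -/
def MemHper (s : ℝ) (φ : L2) : Prop := Summable (hperTerm s φ)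

/-- The norm of `H^s_per(0, 2π)`. -/
def hperNorm (s : ℝ) (φ : L2) : ℝ := √(fourierConst φ ^ 2 + ∑' j, hperTerm s φ j)

/-! ### The constants -/

/-- The constants `C_1^(p), …, C_6^(p)` for `p = 1, 2, 3`. -/
def decayConst : ℕ → Fin 6 → ℝ
  | 1 => ![0, 0, 0, √2 / Real.pi, 2 / Real.pi, 0]
  | 2 => ![√2, 2, Real.pi, 3 * √2 / 2, 3, 5]
  | 3 => ![11 * √2, 23, 11 * Real.pi, 44 * √2 / 3, 30, 48]
  | _ => 0

/-- `κ^(p) = (∑ᵢ (C_i^(p))²)^(1/2)`. -/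
def kappa (p : ℕ) : ℝ := √(∑ i, decayConst p i ^ 2)

/-- `γ^(p) = 1 + κ^(p)`. -/
def gamma (p : ℕ) : ℝ := 1 + kappa p

end TrigGalerkin

end

noncomputable section

namespace TrigGalerkin

open scoped InnerProductSpace

/-! ### Calculus of the Volterra operator -/

theorem integral_primitive_mul_deriv {φ H h : ℝ → ℝ} {x : ℝ}
    (hφ : IntervalIntegrable φ volume 0 x) (hH : ∀ t, HasDerivAt H (h t) t) (hh : Continuous h) :
    ∫ s in (0 : ℝ)..x, (∫ t in (0 : ℝ)..s, φ t) * h s =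
      ∫ t in (0 : ℝ)..x, φ t * (H x - H t) := by
  have hf := hφ.absolutelyContinuousOnInterval_intervalIntegral (c := 0) (by simp)
  have hdH : deriv H = h := funext fun t => (hH t).deriv
  have hHd : Differentiable ℝ H := fun t => (hH t).differentiableAt
  have hHc : ContDiff ℝ 1 H := contDiff_one_iff_deriv.mpr ⟨hHd, hdH ▸ hh⟩
  have hg : AbsolutelyContinuousOnInterval H 0 x := hHc.contDiffOn.absolutelyContinuousOnInterval
  have key := hf.integral_mul_deriv_eq_deriv_mul hg
  rw [hdH] at key
  have hd : ∫ s in (0 : ℝ)..x, deriv (fun s => ∫ t in (0 : ℝ)..s, φ t) s * H s =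
      ∫ s in (0 : ℝ)..x, φ s * H s := by
    refine intervalIntegral.integral_congr_ae ?_
    filter_upwards [hφ.ae_hasDerivAt_integral] with s hs hs'
    rw [(hs (uIoc_subset_uIcc hs') 0 (by simp)).deriv]
  rw [hd] at key
  rw [key]
  simp only [mul_sub]
  rw [intervalIntegral.integral_sub (hφ.mul_const _)
    (hφ.mul_continuousOn hHd.continuous.continuousOn), intervalIntegral.integral_mul_const]
  simp

theorem volterraFun_one (φ : ℝ → ℝ) (x : ℝ) :
    volterraFun 1 φ x = ∫ t in (0 : ℝ)..x, φ t := by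
  simp [volterraFun]

theorem coeFn_volterraLin (p : ℕ) (φ : L2) : volterraLin p φ =ᵐ[mu] volterraFun p φ :=
  (memLp_volterraFun p φ).coeFn_toLp

theorem coeFn_volterraLin_one (φ : L2) :
    volterraLin 1 φ =ᵐ[mu] fun x => ∫ t in (0 : ℝ)..x, φ t := by
  filter_upwards [coeFn_volterraLin 1 φ] with x hx
  rw [hx, volterraFun_one]

theorem volterraLin_succ {p : ℕ} (hp : 1 ≤ p) (φ : L2) :
    volterraLin (p + 1) φ = volterraLin p (volterraLin 1 φ) := by
  refine Lp.ext ?_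
  filter_upwards [coeFn_volterraLin (p + 1) φ, coeFn_volterraLin p (volterraLin 1 φ),
    ae_restrict_mem measurableSet_Ioo] with x h1 h2 hx
  rw [h1, h2, volterraFun, volterraFun]
  have e : ∫ t in (0 : ℝ)..x, (x - t) ^ (p - 1) * volterraLin 1 φ t =
      ∫ t in (0 : ℝ)..x, (∫ s in (0 : ℝ)..t, φ s) * (x - t) ^ (p - 1) := by
    refine intervalIntegral.integral_congr_ae_restrict ?_
    rw [uIoc_of_le hx.1.le]
    refine ae_restrict_of_ae_restrict_of_subset
      (fun t ht => ⟨ht.1, ht.2.trans_lt hx.2⟩ : Ioc 0 x ⊆ Ioo 0 (2 * Real.pi)) ?_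
    filter_upwards [coeFn_volterraLin_one φ] with t ht
    rw [ht, mul_comm]
  have hp0 : (p : ℝ) ≠ 0 := by positivity
  have hH : ∀ t, HasDerivAt (fun t : ℝ => -(x - t) ^ p / p) ((x - t) ^ (p - 1)) t := by
    intro t
    have := (((hasDerivAt_id t).const_sub x).pow p).neg.div_const (p : ℝ)
    refine this.congr_deriv ?_
    simp only [id]
    field_simp
  rw [e, integral_primitive_mul_deriv (intervalIntegrable_L2 φ hx) hH (by fun_prop)]
  have e2 : ∀ t : ℝ, φ t * (-(x - x) ^ p / p - -(x - t) ^ p / p) =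
      1 / (p : ℝ) * ((x - t) ^ p * φ t) := by
    intro t
    rw [sub_self, zero_pow (by omega)]
    ring
  simp only [e2]
  rw [intervalIntegral.integral_const_mul, ← mul_assoc, Nat.add_sub_cancel]
  congr 1
  obtain ⟨q, rfl⟩ : ∃ q, p = q + 1 := ⟨p - 1, by omega⟩
  rw [Nat.add_sub_cancel, Nat.factorial_succ]
  push_cast
  field_simp

theorem intervalIntegrable_L2_two_pi (φ : L2) : IntervalIntegrable φ volume 0 (2 * Real.pi) := by
  rw [intervalIntegrable_iff_integrableOn_Ioo_of_le Real.two_pi_pos.le]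
  exact integrable_L2 φ

theorem integral_volterraLin_one_mul (φ : L2) {H h : ℝ → ℝ} (hH : ∀ t, HasDerivAt H (h t) t)
    (hh : Continuous h) :
    ∫ x in Ioo 0 (2 * Real.pi), volterraLin 1 φ x * h x =
      ∫ t in Ioo 0 (2 * Real.pi), φ t * (H (2 * Real.pi) - H t) := by
  have key := integral_primitive_mul_deriv (intervalIntegrable_L2_two_pi φ) hH hh
  rw [intervalIntegral.integral_of_le Real.two_pi_pos.le,
    intervalIntegral.integral_of_le Real.two_pi_pos.le, integral_Ioc_eq_integral_Ioo,
    integral_Ioc_eq_integral_Ioo] at key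
  rw [← key]
  refine integral_congr_ae ?_
  filter_upwards [coeFn_volterraLin_one φ] with x hx
  rw [hx]

/-! ### Weak derivatives and initial values -/

theorem integral_volterraLin_one_mul_deriv (φ : L2) {h : ℝ → ℝ} (hh : ContDiff ℝ ∞ h)
    (hs : tsupport h ⊆ Ioo 0 (2 * Real.pi)) :
    ∫ x in Ioo 0 (2 * Real.pi), volterraLin 1 φ x * deriv h x =
      -∫ t in Ioo 0 (2 * Real.pi), φ t * h t := by
  rw [integral_volterraLin_one_mul φ (H := h)
    (fun t => (hh.differentiable (by simp) t).hasDerivAt) (hh.continuous_deriv (by simp))]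
  have h0 : h (2 * Real.pi) = 0 := image_eq_zero_of_notMem_tsupport fun hm => by
    simpa using (hs hm).2
  simp [h0, integral_neg]

theorem hasWeakDeriv_iterate_volterraLin (k : ℕ) (φ : L2) :
    HasWeakDeriv k ((volterraLin 1)^[k] φ) φ := by
  induction k with
  | zero => intro h _ _ _; simp
  | succ k ih =>
    intro h hh hc hs
    rw [ih h hh hc hs, Function.iterate_succ_apply', iteratedDeriv_succ,
      integral_volterraLin_one_mul_deriv]
    · rw [pow_succ]; ring
    · rw [iteratedDeriv_eq_iterate]
      exact hh.iterate_deriv k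
    · rw [iteratedDeriv_eq_iterate]
      clear ih
      induction k with
      | zero => exact hs
      | succ k ih =>
        rw [Function.iterate_succ_apply']
        exact (tsupport_deriv_subset).trans ih

theorem HasWeakDeriv.unique {k : ℕ} {y ζ ζ' : L2} (h : HasWeakDeriv k y ζ)
    (h' : HasWeakDeriv k y ζ') : ζ = ζ' := by
  refine Lp.ext ?_
  rw [Filter.EventuallyEq, ae_restrict_iff' measurableSet_Ioo]
  have hi : LocallyIntegrableOn (fun x => ζ x - ζ' x) (Ioo 0 (2 * Real.pi)) volume :=
    IntegrableOn.locallyIntegrableOn ((integrable_L2 ζ).sub (integrable_L2 ζ'))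
  have := isOpen_Ioo.ae_eq_zero_of_integral_contDiff_smul_eq_zero hi (fun g hg hc hs => by
    have hcont := hg.continuous
    obtain ⟨C, hC⟩ := hcont.bounded_above_of_compact_support hc
    have hint : ∀ f : L2, Integrable (fun x => f x * g x) mu := fun f =>
      (integrable_L2 f).mul_bdd (c := C) hcont.aestronglyMeasurable (Eventually.of_forall hC)
    have e := (h g hg hc hs).trans (h' g hg hc hs).symm
    have e2 : ∫ x in Ioo 0 (2 * Real.pi), g x • (ζ x - ζ' x) = 0 := by
      have : ∀ x, g x • (ζ x - ζ' x) = ζ x * g x - ζ' x * g x := fun x => by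
        rw [smul_eq_mul]; ring
      simp only [this]
      rw [integral_sub (hint ζ) (hint ζ'), e, sub_self]
    rw [← setIntegral_eq_integral_of_forall_compl_eq_zero (s := Ioo 0 (2 * Real.pi)), e2]
    intro x hx
    rw [image_eq_zero_of_notMem_tsupport (fun hm => hx (hs hm)), zero_smul])
  filter_upwards [this] with x hx hx'
  exact sub_eq_zero.mp (hx hx')

theorem MemH0.exists_eq_iterate_volterraLin {p : ℕ} (hp : 1 ≤ p) {y : L2} (hy : MemH0 p y) :
    ∃ Ψ : L2, y = (volterraLin 1)^[p] Ψ := by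
  obtain ⟨-, f, ⟨hf, Ψ, α, hα⟩, hyf, h0⟩ := hy
  have hpi := Real.two_pi_pos
  set I := Icc 0 (2 * Real.pi) with hI
  have hud : UniqueDiffOn ℝ I := uniqueDiffOn_Icc hpi
  have hα0 : α = 0 := by
    have := hα 0 (left_mem_Icc.mpr hpi.le)
    rw [h0 (p - 1) (by omega)] at this
    simpa using this.symm
  have hstep : ∀ k, k + 1 ≤ p - 1 → ∀ x ∈ Ioo 0 (2 * Real.pi),
      ∫ t in (0 : ℝ)..x, iteratedDerivWithin (k + 1) f I t = iteratedDerivWithin k f I x := by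
    intro k hk x hx
    have hdiff : DifferentiableOn ℝ (iteratedDerivWithin k f I) I :=
      hf.differentiableOn_iteratedDerivWithin (by exact_mod_cast hk) hud
    have hcont : ContinuousOn (iteratedDerivWithin (k + 1) f I) I :=
      hf.continuousOn_iteratedDerivWithin (by exact_mod_cast hk) hud
    have hsub : Icc 0 x ⊆ I := Icc_subset_Icc_right hx.2.le
    rw [intervalIntegral.integral_eq_sub_of_hasDerivAt_of_le (f := iteratedDerivWithin k f I)
      hx.1.le (hdiff.continuousOn.mono hsub), h0 k (by omega), sub_zero]
    · intro t ht
      have htI : I ∈ 𝓝 t := Icc_mem_nhds ht.1 (ht.2.trans hx.2)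
      rw [iteratedDerivWithin_succ]
      exact ((hdiff t (mem_of_mem_nhds htI)).hasDerivWithinAt).hasDerivAt htI
    · refine ContinuousOn.intervalIntegrable ?_
      rw [uIcc_of_le hx.1.le]
      exact hcont.mono hsub
  have main : ∀ j, j ≤ p - 1 →
      (volterraLin 1)^[j + 1] Ψ =ᵐ[mu] iteratedDerivWithin (p - 1 - j) f I := by
    intro j
    induction j with
    | zero =>
      intro _
      filter_upwards [coeFn_volterraLin_one Ψ, ae_restrict_mem measurableSet_Ioo] with x hx hxI
      rw [Function.iterate_succ_apply', Function.iterate_zero_apply, hx, Nat.sub_zero,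
        hα x (Ioo_subset_Icc_self hxI), hα0, zero_add]
    | succ j ih =>
      intro hj
      rw [Function.iterate_succ_apply']
      filter_upwards [coeFn_volterraLin_one ((volterraLin 1)^[j + 1] Ψ),
        ae_restrict_mem measurableSet_Ioo] with x hx hxI
      rw [hx, ← hstep (p - 1 - (j + 1)) (by omega) x hxI,
        show p - 1 - (j + 1) + 1 = p - 1 - j by omega]
      refine intervalIntegral.integral_congr_ae_restrict ?_
      rw [uIoc_of_le hxI.1.le]
      exact ae_restrict_of_ae_restrict_of_subset
        (fun t ht => ⟨ht.1, ht.2.trans_lt hxI.2⟩ : Ioc 0 x ⊆ Ioo 0 (2 * Real.pi)) (ih (by omega))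
  refine ⟨Ψ, Lp.ext ?_⟩
  have := main (p - 1) le_rfl
  rw [Nat.sub_add_cancel hp, Nat.sub_self, iteratedDerivWithin_zero] at this
  exact hyf.trans this.symm

theorem volterraLin_eq_iterate {p : ℕ} (hp : 1 ≤ p) (φ : L2) :
    volterraLin p φ = (volterraLin 1)^[p] φ := by
  induction p, hp using Nat.le_induction generalizing φ with
  | base => rfl
  | succ p hp ih => rw [volterraLin_succ hp, ih, Function.iterate_succ_apply]

/-- A function in `H^p` with vanishing initial values is `A^(p)` of its `p`-th weak derivative. -/
theorem MemH0.eq_volterraLin {p : ℕ} (hp : 1 ≤ p) {y yp : L2} (hy : MemH0 p y)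
    (hyp : HasWeakDeriv p y yp) : y = volterraLin p yp := by
  obtain ⟨Ψ, rfl⟩ := hy.exists_eq_iterate_volterraLin hp
  rw [volterraLin_eq_iterate hp, hyp.unique (hasWeakDeriv_iterate_volterraLin p Ψ)]

theorem hasSum_of_eq {f g : ℕ → ℝ} {a b : ℝ} (h : HasSum f a) (hfg : ∀ j, g j = f j)
    (hab : b = a) : HasSum g b := by
  rw [hab, funext hfg]
  exact h

theorem sin_int_mul_two_pi (n : ℤ) : Real.sin (n * (2 * Real.pi)) = 0 := by
  have := Real.sin_int_mul_pi (2 * n)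
  push_cast at this
  rw [← this]
  ring_nf

/-! ### Fourier coefficients and Parseval's identity -/

theorem inner_toLp_left {h : ℝ → ℝ} (hh : MemLp h 2 mu) (φ : L2) :
    ⟪hh.toLp h, φ⟫_ℝ = ∫ t in Ioo 0 (2 * Real.pi), φ t * h t := by
  rw [L2.inner_def]
  refine integral_congr_ae ?_
  filter_upwards [hh.coeFn_toLp] with t ht
  rw [ht]
  simp

theorem inner_constE (φ : L2) : ⟪constE, φ⟫_ℝ = fourierConst φ := by
  rw [constE, inner_toLp_left, integral_mul_const, fourierConst, mul_comm]

theorem inner_cosE (k : ℕ) (φ : L2) : ⟪cosE k, φ⟫_ℝ = fourierCos k φ := by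
  rw [cosE, inner_toLp_left, fourierCos, ← integral_const_mul]
  congr 1; ext t; ring

theorem inner_sinE (k : ℕ) (φ : L2) : ⟪sinE k, φ⟫_ℝ = fourierSin k φ := by
  rw [sinE, inner_toLp_left, fourierSin, ← integral_const_mul]
  congr 1; ext t; ring

theorem norm_sq_eq_integral (φ : L2) : ‖φ‖ ^ 2 = ∫ t in Ioo 0 (2 * Real.pi), φ t ^ 2 := by
  rw [← real_inner_self_eq_norm_sq, L2.inner_def]
  congr 1; ext t
  simp [sq]

theorem fourierCoeffOn_ofReal (φ : L2) (n : ℤ) :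
    fourierCoeffOn Real.two_pi_pos (fun x => (φ x : ℂ)) n =
      (((1 / (2 * Real.pi) * ∫ t in Ioo 0 (2 * Real.pi), φ t * Real.cos (n * t) : ℝ)) : ℂ) -
      (((1 / (2 * Real.pi) * ∫ t in Ioo 0 (2 * Real.pi), φ t * Real.sin (n * t) : ℝ)) : ℂ) *
        Complex.I := by
  have hc : Integrable (fun t => φ t * Real.cos (n * t)) mu :=
    (integrable_L2 φ).mul_bdd (c := 1) (by fun_prop)
      (Eventually.of_forall fun t => Real.abs_cos_le_one _)
  have hs : Integrable (fun t => φ t * Real.sin (n * t)) mu :=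
    (integrable_L2 φ).mul_bdd (c := 1) (by fun_prop)
      (Eventually.of_forall fun t => Real.abs_sin_le_one _)
  rw [fourierCoeffOn_eq_integral, intervalIntegral.integral_of_le Real.two_pi_pos.le,
    integral_Ioc_eq_integral_Ioo]
  have e : ∀ x : ℝ, (fourier (-n) (x : AddCircle (2 * Real.pi - 0)) : ℂ) • (φ x : ℂ) =
      ((φ x * Real.cos (n * x) : ℝ) : ℂ) - ((φ x * Real.sin (n * x) : ℝ) : ℂ) * Complex.I := by
    intro x
    rw [fourier_coe_apply]
    have : (2 * Real.pi * Complex.I * ((-n : ℤ) : ℂ) * x / ((2 * Real.pi - 0 : ℝ) : ℂ)) =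
        ((-(n * x) : ℝ) : ℂ) * Complex.I := by
      have : (Real.pi : ℂ) ≠ 0 := by exact_mod_cast Real.pi_ne_zero
      push_cast
      rw [sub_zero]
      field_simp
    rw [this, Complex.exp_mul_I, ← Complex.ofReal_cos, ← Complex.ofReal_sin, Real.cos_neg,
      Real.sin_neg, smul_eq_mul]
    push_cast
    ring
  simp only [e]
  rw [integral_sub hc.ofReal (hs.ofReal.mul_const _), integral_mul_const, integral_complex_ofReal,
    integral_complex_ofReal, sub_zero, Complex.real_smul]
  push_cast
  ring

/-- Parseval's identity. -/
theorem hasSum_sq_fourier (φ : L2) :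
    HasSum (fun j : ℕ => fourierCos (j + 1) φ ^ 2 + fourierSin (j + 1) φ ^ 2)
      (‖φ‖ ^ 2 - fourierConst φ ^ 2) := by
  have hpi := Real.pi_pos
  have hL : MemLp (fun x => (φ x : ℂ)) 2 (volume.restrict (Ioc 0 (2 * Real.pi))) := by
    rw [← restrict_Ioo_eq_restrict_Ioc]
    exact (Lp.memLp φ).ofReal
  have h := (hasSum_sq_fourierCoeffOn Real.two_pi_pos hL).nat_add_neg
  rw [← hasSum_nat_add_iff' 1] at h
  have h := h.mul_left (2 * Real.pi)
  have hnorm : ∀ n : ℤ, ‖fourierCoeffOn Real.two_pi_pos (fun x => (φ x : ℂ)) n‖ ^ 2 =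
      (1 / (2 * Real.pi)) ^ 2 * ((∫ t in Ioo 0 (2 * Real.pi), φ t * Real.cos (n * t)) ^ 2 +
        (∫ t in Ioo 0 (2 * Real.pi), φ t * Real.sin (n * t)) ^ 2) := by
    intro n
    rw [fourierCoeffOn_ofReal, Complex.sq_norm, Complex.normSq_apply]
    simp
    ring
  have h0 : fourierConst φ ^ 2 = 1 / (2 * Real.pi) * (∫ t in Ioo 0 (2 * Real.pi), φ t) ^ 2 := by
    rw [fourierConst, mul_pow, div_pow, Real.sq_sqrt (by positivity), one_pow]
  have hk : ∀ k : ℕ, fourierCos k φ ^ 2 + fourierSin k φ ^ 2 = 1 / Real.pi *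
      ((∫ t in Ioo 0 (2 * Real.pi), φ t * Real.cos (k * t)) ^ 2 +
        (∫ t in Ioo 0 (2 * Real.pi), φ t * Real.sin (k * t)) ^ 2) := by
    intro k
    rw [fourierCos, fourierSin, mul_pow, mul_pow, div_pow, Real.sq_sqrt (by positivity), one_pow]
    ring
  refine hasSum_of_eq h (fun j => ?_) ?_
  · rw [hk, hnorm, hnorm]
    simp only [Int.cast_neg, Int.cast_natCast, neg_mul, Real.cos_neg, Real.sin_neg, mul_neg,
      integral_neg, neg_sq]
    field_simp
    ring
  · rw [h0, norm_sq_eq_integral, Finset.sum_range_one]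
    simp only [Nat.cast_zero, neg_zero, hnorm]
    rw [intervalIntegral.integral_of_le Real.two_pi_pos.le, integral_Ioc_eq_integral_Ioo]
    simp
    field_simp

@[simp] theorem fourierConst_add (φ ψ : L2) :
    fourierConst (φ + ψ) = fourierConst φ + fourierConst ψ := by
  simp only [← inner_constE, inner_add_right]
@[simp] theorem fourierConst_sub (φ ψ : L2) :
    fourierConst (φ - ψ) = fourierConst φ - fourierConst ψ := by
  simp only [← inner_constE, inner_sub_right]
@[simp] theorem fourierConst_smul (r : ℝ) (φ : L2) :
    fourierConst (r • φ) = r * fourierConst φ := by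
  simp only [← inner_constE, inner_smul_right]
@[simp] theorem fourierCos_add (k : ℕ) (φ ψ : L2) :
    fourierCos k (φ + ψ) = fourierCos k φ + fourierCos k ψ := by
  simp only [← inner_cosE, inner_add_right]
@[simp] theorem fourierCos_sub (k : ℕ) (φ ψ : L2) :
    fourierCos k (φ - ψ) = fourierCos k φ - fourierCos k ψ := by
  simp only [← inner_cosE, inner_sub_right]
@[simp] theorem fourierCos_smul (k : ℕ) (r : ℝ) (φ : L2) :
    fourierCos k (r • φ) = r * fourierCos k φ := by
  simp only [← inner_cosE, inner_smul_right]
@[simp] theorem fourierSin_add (k : ℕ) (φ ψ : L2) :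
    fourierSin k (φ + ψ) = fourierSin k φ + fourierSin k ψ := by
  simp only [← inner_sinE, inner_add_right]
@[simp] theorem fourierSin_sub (k : ℕ) (φ ψ : L2) :
    fourierSin k (φ - ψ) = fourierSin k φ - fourierSin k ψ := by
  simp only [← inner_sinE, inner_sub_right]
@[simp] theorem fourierSin_smul (k : ℕ) (r : ℝ) (φ : L2) :
    fourierSin k (r • φ) = r * fourierSin k φ := by
  simp only [← inner_sinE, inner_smul_right]

/-- The polarised form of Parseval's identity. -/
theorem hasSum_fourier_mul (φ ψ : L2) :
    HasSum (fun j : ℕ => fourierCos (j + 1) φ * fourierCos (j + 1) ψ +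
      fourierSin (j + 1) φ * fourierSin (j + 1) ψ)
      (⟪φ, ψ⟫_ℝ - fourierConst φ * fourierConst ψ) := by
  have h := ((hasSum_sq_fourier (φ + ψ)).sub (hasSum_sq_fourier (φ - ψ))).mul_left (1 / 4 : ℝ)
  refine hasSum_of_eq h (fun j => ?_) ?_
  · simp
    ring
  · rw [norm_add_sq_real, norm_sub_sq_real]
    simp
    ring

/-! ### Orthogonality of the trigonometric system -/

theorem integral_cos_int_mul {n : ℤ} (hn : n ≠ 0) :
    ∫ t in Ioo 0 (2 * Real.pi), Real.cos (n * t) = 0 := by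
  have hn' : (n : ℝ) ≠ 0 := by exact_mod_cast hn
  rw [← integral_Ioc_eq_integral_Ioo, ← intervalIntegral.integral_of_le Real.two_pi_pos.le,
    intervalIntegral.integral_comp_mul_left (fun x => Real.cos x) hn', integral_cos]
  simp [sin_int_mul_two_pi]

theorem integral_sin_int_mul (n : ℤ) :
    ∫ t in Ioo 0 (2 * Real.pi), Real.sin (n * t) = 0 := by
  rcases eq_or_ne n 0 with rfl | hn
  · simp
  have hn' : (n : ℝ) ≠ 0 := by exact_mod_cast hn
  rw [← integral_Ioc_eq_integral_Ioo, ← intervalIntegral.integral_of_le Real.two_pi_pos.le,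
    intervalIntegral.integral_comp_mul_left (fun x => Real.sin x) hn', integral_sin]
  simp [Real.cos_int_mul_two_pi]

theorem integrable_cos_mul (r : ℝ) : Integrable (fun t => Real.cos (r * t)) mu :=
  Integrable.of_bound (by fun_prop) 1 (Eventually.of_forall fun t => Real.abs_cos_le_one _)

theorem integrable_sin_mul (r : ℝ) : Integrable (fun t => Real.sin (r * t)) mu :=
  Integrable.of_bound (by fun_prop) 1 (Eventually.of_forall fun t => Real.abs_sin_le_one _)

theorem integral_toLp_mul {h : ℝ → ℝ} (hh : MemLp h 2 mu) (g : ℝ → ℝ) :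
    ∫ t in Ioo 0 (2 * Real.pi), hh.toLp h t * g t = ∫ t in Ioo 0 (2 * Real.pi), h t * g t := by
  refine integral_congr_ae ?_
  filter_upwards [hh.coeFn_toLp] with t ht
  rw [ht]

theorem fourierConst_constE : fourierConst constE = 1 := by
  have h := integral_toLp_mul memLp_constE (fun _ => 1)
  simp only [mul_one] at h
  rw [fourierConst, constE, h]
  have : (2 * Real.pi) = √(2 * Real.pi) * √(2 * Real.pi) :=
    (Real.mul_self_sqrt Real.two_pi_pos.le).symm
  have h0 : √(2 * Real.pi) ≠ 0 := (Real.sqrt_pos.mpr Real.two_pi_pos).ne'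
  rw [integral_const, Measure.real, Measure.restrict_apply_univ, Real.volume_Ioo, sub_zero,
    ENNReal.toReal_ofReal Real.two_pi_pos.le, smul_eq_mul]
  field_simp
  rw [Real.sq_sqrt Real.two_pi_pos.le]

theorem fourierCos_constE {k : ℕ} (hk : k ≠ 0) : fourierCos k constE = 0 := by
  rw [fourierCos, constE, integral_toLp_mul, integral_const_mul]
  have := integral_cos_int_mul (n := k) (by exact_mod_cast hk)
  rw [Int.cast_natCast] at this
  simp [this]

theorem fourierSin_constE (k : ℕ) : fourierSin k constE = 0 := by
  rw [fourierSin, constE, integral_toLp_mul, integral_const_mul]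
  have := integral_sin_int_mul (n := k)
  rw [Int.cast_natCast] at this
  simp [this]

theorem fourierCos_cosE {k m : ℕ} (hk : k ≠ m) : fourierCos k (cosE m) = 0 := by
  rw [fourierCos, cosE, integral_toLp_mul]
  have e : ∀ t : ℝ, Real.cos (m * t) / √Real.pi * Real.cos (k * t) =
      1 / (2 * √Real.pi) * (Real.cos (((m - k : ℤ) : ℝ) * t) +
        Real.cos (((m + k : ℤ) : ℝ) * t)) := by
    intro t
    push_cast
    rw [sub_mul, add_mul, Real.cos_sub, Real.cos_add]
    ring
  simp only [e]
  rw [integral_const_mul, integral_add (integrable_cos_mul _) (integrable_cos_mul _),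
    integral_cos_int_mul (by omega), integral_cos_int_mul (by omega)]
  simp

theorem fourierSin_sinE {k m : ℕ} (hk : k ≠ m) : fourierSin k (sinE m) = 0 := by
  rw [fourierSin, sinE, integral_toLp_mul]
  have e : ∀ t : ℝ, Real.sin (m * t) / √Real.pi * Real.sin (k * t) =
      1 / (2 * √Real.pi) * (Real.cos (((m - k : ℤ) : ℝ) * t) -
        Real.cos (((m + k : ℤ) : ℝ) * t)) := by
    intro t
    push_cast
    rw [sub_mul, add_mul, Real.cos_sub, Real.cos_add]
    ring
  simp only [e]
  rw [integral_const_mul, integral_sub (integrable_cos_mul _) (integrable_cos_mul _),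
    integral_cos_int_mul (by omega), integral_cos_int_mul (by omega)]
  simp

theorem fourierSin_cosE (k m : ℕ) : fourierSin k (cosE m) = 0 := by
  rw [fourierSin, cosE, integral_toLp_mul]
  have e : ∀ t : ℝ, Real.cos (m * t) / √Real.pi * Real.sin (k * t) =
      1 / (2 * √Real.pi) * (Real.sin (((k + m : ℤ) : ℝ) * t) +
        Real.sin (((k - m : ℤ) : ℝ) * t)) := by
    intro t
    push_cast
    rw [sub_mul, add_mul, Real.sin_sub, Real.sin_add]
    ring
  simp only [e]
  rw [integral_const_mul, integral_add (integrable_sin_mul _) (integrable_sin_mul _),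
    integral_sin_int_mul, integral_sin_int_mul]
  simp

theorem fourierCos_sinE (k m : ℕ) : fourierCos k (sinE m) = 0 := by
  rw [← inner_cosE, real_inner_comm, inner_sinE, fourierSin_cosE]

theorem fourier_eq_zero_of_mem_trigSpace {n k : ℕ} (hk : n < k) {u : L2} (hu : u ∈ trigSpace n) :
    fourierCos k u = 0 ∧ fourierSin k u = 0 := by
  induction hu using Submodule.span_induction with
  | mem x hx =>
    rcases hx with (hx | ⟨m, hm, rfl⟩) | ⟨m, hm, rfl⟩
    · rw [mem_singleton_iff.mp hx]
      exact ⟨fourierCos_constE (by omega), fourierSin_constE k⟩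
    · exact ⟨fourierCos_cosE (by have := hm.2; omega), fourierSin_cosE k m⟩
    · exact ⟨fourierCos_sinE k m, fourierSin_sinE (by have := hm.2; omega)⟩
  | zero => exact ⟨by simpa using fourierCos_smul k 0 0, by simpa using fourierSin_smul k 0 0⟩
  | add x y _ _ hx hy => simp [hx.1, hx.2, hy.1, hy.2]
  | smul r x _ hx => simp [hx.1, hx.2]

theorem fourier_eq_zero_of_mem_orthogonal {n : ℕ} {g : L2} (hg : g ∈ (trigSpace n)ᗮ) :
    fourierConst g = 0 ∧ ∀ k, 1 ≤ k → k ≤ n → fourierCos k g = 0 ∧ fourierSin k g = 0 := by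
  have h := fun v (hv : v ∈ trigSpace n) => Submodule.inner_right_of_mem_orthogonal hv hg
  refine ⟨?_, fun k hk hkn => ⟨?_, ?_⟩⟩
  · rw [← inner_constE]
    exact h _ (Submodule.subset_span (Or.inl (Or.inl rfl)))
  · rw [← inner_cosE]
    exact h _ (Submodule.subset_span (Or.inl (Or.inr ⟨k, ⟨hk, hkn⟩, rfl⟩)))
  · rw [← inner_sinE]
    exact h _ (Submodule.subset_span (Or.inr ⟨k, ⟨hk, hkn⟩, rfl⟩))

/-! ### The Volterra operator on the Fourier side -/

theorem fourierCos_volterraLin_one {k : ℕ} (hk : k ≠ 0) (φ : L2) :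
    fourierCos k (volterraLin 1 φ) = -fourierSin k φ / k := by
  have hk' : (k : ℝ) ≠ 0 := by exact_mod_cast hk
  have hH : ∀ t : ℝ, HasDerivAt (fun t => Real.sin (k * t) / k) (Real.cos (k * t)) t := by
    intro t
    refine ((((hasDerivAt_id t).const_mul (k : ℝ)).sin).div_const (k : ℝ)).congr_deriv ?_
    simp [hk']
  rw [fourierCos, integral_volterraLin_one_mul φ hH (by fun_prop), fourierSin]
  have e : ∀ t, φ t * (Real.sin (k * (2 * Real.pi)) / k - Real.sin (k * t) / k) =
      -(1 / k) * (φ t * Real.sin (k * t)) := by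
    intro t
    have := sin_int_mul_two_pi k
    rw [Int.cast_natCast] at this
    rw [this]
    ring
  simp only [e]
  rw [integral_const_mul]
  ring

theorem fourierSin_volterraLin_one {k : ℕ} (hk : k ≠ 0) (φ : L2) :
    fourierSin k (volterraLin 1 φ) = (fourierCos k φ - √2 * fourierConst φ) / k := by
  have hk' : (k : ℝ) ≠ 0 := by exact_mod_cast hk
  have hH : ∀ t : ℝ, HasDerivAt (fun t => -Real.cos (k * t) / k) (Real.sin (k * t)) t := by
    intro t
    refine ((((hasDerivAt_id t).const_mul (k : ℝ)).cos).neg.div_const (k : ℝ)).congr_deriv ?_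
    simp [hk']
  rw [fourierSin, integral_volterraLin_one_mul φ hH (by fun_prop), fourierCos, fourierConst]
  have e : ∀ t, φ t * (-Real.cos (k * (2 * Real.pi)) / k - -Real.cos (k * t) / k) =
      1 / k * (φ t * Real.cos (k * t) - φ t) := by
    intro t
    have := Real.cos_int_mul_two_pi k
    rw [Int.cast_natCast] at this
    rw [this]
    ring
  simp only [e]
  rw [integral_const_mul, integral_sub _ (integrable_L2 φ), Real.sqrt_mul (by norm_num)]
  · have : √(2 : ℝ) ≠ 0 := by positivity
    have : √Real.pi ≠ 0 := (Real.sqrt_pos.mpr Real.pi_pos).ne'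
    field_simp
  · exact (integrable_L2 φ).mul_bdd (c := 1) (by fun_prop)
      (Eventually.of_forall fun t => Real.abs_cos_le_one _)

theorem integral_volterraLin_one (φ : L2) :
    ∫ x in Ioo 0 (2 * Real.pi), volterraLin 1 φ x =
      ∫ t in Ioo 0 (2 * Real.pi), φ t * (2 * Real.pi - t) := by
  simpa using integral_volterraLin_one_mul φ (H := fun t => t) (h := fun _ => 1)
    (fun t => hasDerivAt_id t) continuous_const

theorem fourierConst_volterraLin_one_constE :
    fourierConst (volterraLin 1 constE) = Real.pi := by
  rw [fourierConst, integral_volterraLin_one, constE, integral_toLp_mul, integral_const_mul,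
    ← integral_Ioc_eq_integral_Ioo, ← intervalIntegral.integral_of_le Real.two_pi_pos.le,
    intervalIntegral.integral_comp_sub_left (fun x => x), integral_id, ← mul_assoc, div_mul_div_comm,
    Real.mul_self_sqrt Real.two_pi_pos.le]
  have := Real.pi_ne_zero
  field_simp
  ring

theorem fourierConst_volterraLin_one_eq_inner (φ : L2) :
    fourierConst (volterraLin 1 φ) =
      ⟪(2 * Real.pi) • constE - volterraLin 1 constE, φ⟫_ℝ := by
  rw [fourierConst, integral_volterraLin_one, L2.inner_def, ← integral_const_mul]
  refine integral_congr_ae ?_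
  filter_upwards [Lp.coeFn_sub ((2 * Real.pi) • constE) (volterraLin 1 constE),
    Lp.coeFn_smul (2 * Real.pi) constE, coeFn_volterraLin_one constE, memLp_constE.coeFn_toLp,
    ae_restrict_mem measurableSet_Ioo] with x h1 h2 h3 h4 hx
  have h5 : ∫ t in (0 : ℝ)..x, constE t = x * (1 / √(2 * Real.pi)) := by
    have : ∫ t in (0 : ℝ)..x, constE t = ∫ t in (0 : ℝ)..x, 1 / √(2 * Real.pi) := by
      refine intervalIntegral.integral_congr_ae_restrict ?_
      rw [uIoc_of_le hx.1.le]
      exact ae_restrict_of_ae_restrict_of_subset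
        (fun t ht => ⟨ht.1, ht.2.trans_lt hx.2⟩ : Ioc 0 x ⊆ Ioo 0 (2 * Real.pi))
        memLp_constE.coeFn_toLp
    rw [this, intervalIntegral.integral_const]
    simp
  have h4' : constE x = 1 / √(2 * Real.pi) := h4
  rw [h1, Pi.sub_apply, h2, Pi.smul_apply, h3, h5, h4']
  simp only [smul_eq_mul, RCLike.inner_apply, conj_trivial]
  ring

theorem hasSum_fourierConst_volterraLin_one (φ : L2) :
    HasSum (fun j : ℕ => √2 * (fourierSin (j + 1) φ / (j + 1 : ℕ)))
      (fourierConst (volterraLin 1 φ) - Real.pi * fourierConst φ) := by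
  have h := hasSum_fourier_mul ((2 * Real.pi) • constE - volterraLin 1 constE) φ
  rw [← fourierConst_volterraLin_one_eq_inner] at h
  refine hasSum_of_eq h (fun j => ?_) ?_
  · have hj : j + 1 ≠ 0 := j.succ_ne_zero
    simp only [fourierCos_sub, fourierSin_sub, fourierCos_smul, fourierSin_smul,
      fourierCos_constE hj, fourierSin_constE, fourierCos_volterraLin_one hj,
      fourierSin_volterraLin_one hj, fourierConst_constE]
    ring
  · rw [fourierConst_sub, fourierConst_smul, fourierConst_constE,
      fourierConst_volterraLin_one_constE]
    ring

/-! ### The distance to the trigonometric subspaces -/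

theorem sub_proj_mem_orthogonal (n : ℕ) (φ : L2) : φ - proj n φ ∈ (trigSpace n)ᗮ :=
  Submodule.sub_starProjection_mem_orthogonal φ

theorem proj_mem_trigSpace (n : ℕ) (φ : L2) : proj n φ ∈ trigSpace n :=
  (projTo n φ).2

theorem hasSum_sq_fourier_tail (n : ℕ) (φ : L2) :
    HasSum (fun j : ℕ => fourierCos (j + n + 1) φ ^ 2 + fourierSin (j + n + 1) φ ^ 2)
      (‖φ - proj n φ‖ ^ 2) := by
  have h := hasSum_sq_fourier (φ - proj n φ)
  obtain ⟨h0, hk⟩ := fourier_eq_zero_of_mem_orthogonal (sub_proj_mem_orthogonal n φ)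
  have hlow : ∑ j ∈ Finset.range n,
      (fourierCos (j + 1) (φ - proj n φ) ^ 2 + fourierSin (j + 1) (φ - proj n φ) ^ 2) = 0 := by
    refine Finset.sum_eq_zero fun j hj => ?_
    have := hk (j + 1) (by omega) (by simpa using hj)
    simp only [this.1, this.2]
    ring
  rw [h0, ← hasSum_nat_add_iff' n, hlow] at h
  refine hasSum_of_eq h (fun j => ?_) (by ring)
  have := fourier_eq_zero_of_mem_trigSpace (by omega : n < j + n + 1) (proj_mem_trigSpace n φ)
  simp [this.1, this.2]

theorem norm_sq_proj (n : ℕ) (φ : L2) :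
    ‖proj n φ‖ ^ 2 = fourierConst φ ^ 2 + ∑ j ∈ Finset.range n,
      (fourierCos (j + 1) φ ^ 2 + fourierSin (j + 1) φ ^ 2) := by
  have h := (hasSum_nat_add_iff' n).mpr (hasSum_sq_fourier φ)
  have h2 := h.unique (hasSum_sq_fourier_tail n φ)
  have h3 : ⟪proj n φ, φ - proj n φ⟫_ℝ = 0 :=
    Submodule.inner_right_of_mem_orthogonal (proj_mem_trigSpace n φ) (sub_proj_mem_orthogonal n φ)
  have h4 := norm_add_sq_real (proj n φ) (φ - proj n φ)
  rw [h3, add_sub_cancel] at h4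
  linarith

theorem tendsto_norm_sub_proj (φ : L2) :
    Tendsto (fun n => ‖φ - proj n φ‖) atTop (𝓝 0) := by
  have h : Tendsto (fun n => ‖φ - proj n φ‖ ^ 2) atTop (𝓝 0) := by
    refine (tendsto_sum_nat_add
      (fun j => fourierCos (j + 1) φ ^ 2 + fourierSin (j + 1) φ ^ 2)).congr fun n => ?_
    exact (hasSum_sq_fourier_tail n φ).tsum_eq
  simpa using h.sqrt

theorem norm_sub_proj_le {l : ℝ} (hl : 0 < l) {φ : L2} (hφ : MemHper l φ) {n : ℕ} (hn : 1 ≤ n) :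
    ‖φ - proj n φ‖ ≤ 1 / (n : ℝ) ^ l * hperNorm l φ := by
  have hn0 : (0 : ℝ) < n := by exact_mod_cast hn
  have hnl : (0 : ℝ) < (n : ℝ) ^ l := Real.rpow_pos_of_pos hn0 l
  have hterm : ∀ j, 0 ≤ hperTerm l φ j := fun j => by unfold hperTerm; positivity
  have h := hasSum_sq_fourier_tail n φ
  have hsum : Summable fun j => hperTerm l φ (j + n) := (summable_nat_add_iff n).mpr hφ
  have h1 : ((n : ℝ) ^ l) ^ 2 * ‖φ - proj n φ‖ ^ 2 ≤ ∑' j, hperTerm l φ (j + n) := by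
    refine hasSum_le (fun j => ?_) (h.mul_left _) hsum.hasSum
    rw [hperTerm]
    refine mul_le_mul_of_nonneg_right ?_ (by positivity)
    rw [← Real.rpow_natCast, ← Real.rpow_mul hn0.le, mul_comm, Real.rpow_mul hn0.le]
    refine Real.rpow_le_rpow (by positivity) ?_ hl.le
    rw [Real.rpow_natCast]
    push_cast
    have : (0 : ℝ) ≤ j := j.cast_nonneg
    nlinarith
  have h2 : ∑' j, hperTerm l φ (j + n) ≤ ∑' j, hperTerm l φ j := by
    have := hφ.sum_add_tsum_nat_add n
    have h3 : 0 ≤ ∑ i ∈ Finset.range n, hperTerm l φ i := Finset.sum_nonneg fun i _ => hterm i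
    linarith
  rw [div_mul_eq_mul_div, one_mul, le_div_iff₀ hnl, hperNorm]
  refine Real.le_sqrt_of_sq_le ?_
  nlinarith [sq_nonneg (fourierConst φ)]

/-! ### Tails -/

/-- The tail `∑_{k > n} 1 / k²`. -/
def tailSq (n : ℕ) : ℝ := ∑' j : ℕ, 1 / ((j + n + 1 : ℕ) : ℝ) ^ 2

theorem one_div_sq_le {x : ℝ} (hx : 0 ≤ x) :
    1 / (x + 1) ^ 2 ≤ 2 / (2 * x + 1) - 2 / (2 * (x + 1) + 1) := by
  have e : 2 / (2 * x + 1) - 2 / (2 * (x + 1) + 1) = 4 / ((2 * x + 1) * (2 * (x + 1) + 1)) := by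
    field_simp
    ring
  rw [e, div_le_div_iff₀ (by positivity) (by positivity)]
  nlinarith

theorem sum_range_tailSq_le (n m : ℕ) :
    ∑ j ∈ Finset.range m, 1 / ((j + n + 1 : ℕ) : ℝ) ^ 2 ≤
      (2 / (2 * n + 1) - 2 / (2 * (m + n) + 1) : ℝ) := by
  induction m with
  | zero => simp
  | succ m ih =>
    have h := one_div_sq_le (x := (m + n : ℝ)) (by positivity)
    have e : ((m + 1 : ℕ) : ℝ) + n = m + n + 1 := by push_cast; ring
    rw [Finset.sum_range_succ, e]
    push_cast at ih ⊢
    linarith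

theorem sum_tailSq_le (n : ℕ) (s : Finset ℕ) :
    ∑ j ∈ s, 1 / ((j + n + 1 : ℕ) : ℝ) ^ 2 ≤ (2 / (2 * n + 1) : ℝ) := by
  obtain ⟨m, hm⟩ := s.exists_nat_subset_range
  refine (Finset.sum_le_sum_of_subset_of_nonneg hm fun _ _ _ => by positivity).trans ?_
  refine (sum_range_tailSq_le n m).trans ?_
  have : (0 : ℝ) ≤ 2 / (2 * (m + n) + 1) := by positivity
  linarith

theorem hasSum_tailSq (n : ℕ) :
    HasSum (fun j : ℕ => 1 / ((j + n + 1 : ℕ) : ℝ) ^ 2) (tailSq n) :=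
  (summable_of_sum_le (fun _ => by positivity) (sum_tailSq_le n)).hasSum

theorem tailSq_nonneg (n : ℕ) : 0 ≤ tailSq n := tsum_nonneg fun _ => by positivity

theorem tailSq_le (n : ℕ) : tailSq n ≤ 2 / (2 * n + 1) :=
  (hasSum_tailSq n).summable.tsum_le_of_sum_le (sum_tailSq_le n)

theorem abs_le_of_hasSum_tail {n m : ℕ} {x : ℕ → ℝ} {G S : ℝ} (hG : 0 ≤ G)
    (hx : ∀ s : Finset ℕ, ∑ j ∈ s, x j ^ 2 ≤ G ^ 2)
    (hS : HasSum (fun j => √2 * (x j / ((j + n + 1 : ℕ) : ℝ) ^ (m + 1))) S) :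
    |S| ≤ 2 * G / √(2 * n + 1) * (2 / (2 * n + 1)) ^ m := by
  have hN : (0 : ℝ) < 2 * n + 1 := by positivity
  have hs2 : (√2 : ℝ) ^ 2 = 2 := Real.sq_sqrt (by norm_num)
  have hfin : ∀ s : Finset ℕ, √2 * ∑ j ∈ s, |x j| * (1 / ((j + n + 1 : ℕ) : ℝ)) ≤
      2 * G / √(2 * n + 1) := by
    intro s
    have h := Finset.sum_mul_sq_le_sq_mul_sq s (fun j => |x j|)
      (fun j => 1 / ((j + n + 1 : ℕ) : ℝ))
    simp only [sq_abs, div_pow, one_pow] at h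
    have h2 : (∑ j ∈ s, |x j| * (1 / ((j + n + 1 : ℕ) : ℝ))) ^ 2 ≤ G ^ 2 * (2 / (2 * n + 1)) :=
      h.trans (mul_le_mul (hx s) (sum_tailSq_le n s)
        (Finset.sum_nonneg fun _ _ => by positivity) (by positivity))
    refine abs_le_of_sq_le_sq' (b := 2 * G / √(2 * n + 1)) ?_ (by positivity) |>.2
    rw [mul_pow, hs2, div_pow, mul_pow, Real.sq_sqrt hN.le]
    calc _ ≤ 2 * (G ^ 2 * (2 / (2 * n + 1))) := by gcongr
      _ = _ := by ring
  have hbd : ∀ s : Finset ℕ, |∑ j ∈ s, √2 * (x j / ((j + n + 1 : ℕ) : ℝ) ^ (m + 1))| ≤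
      2 * G / √(2 * n + 1) * (2 / (2 * n + 1)) ^ m := by
    intro s
    refine (Finset.abs_sum_le_sum_abs _ _).trans ?_
    refine le_trans ?_ (mul_le_mul_of_nonneg_right (hfin s) (by positivity))
    rw [mul_assoc, Finset.sum_mul, Finset.mul_sum]
    refine Finset.sum_le_sum fun j _ => ?_
    rw [abs_mul, abs_of_nonneg (Real.sqrt_nonneg 2), abs_div, abs_pow, Nat.abs_cast, pow_succ,
      mul_assoc]
    refine mul_le_mul_of_nonneg_left ?_ (Real.sqrt_nonneg 2)
    have hk : (1 : ℝ) / ((j + n + 1 : ℕ) : ℝ) ≤ 2 / (2 * n + 1) := by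
      rw [div_le_div_iff₀ (by positivity) hN]
      push_cast
      have : (0 : ℝ) ≤ j := j.cast_nonneg
      linarith
    calc |x j| / (((j + n + 1 : ℕ) : ℝ) ^ m * ((j + n + 1 : ℕ) : ℝ))
        = |x j| * (1 / ((j + n + 1 : ℕ) : ℝ) * (1 / ((j + n + 1 : ℕ) : ℝ)) ^ m) := by
          rw [one_div_pow]; field_simp
      _ ≤ |x j| * (1 / ((j + n + 1 : ℕ) : ℝ) * (2 / (2 * n + 1)) ^ m) := by gcongr
  exact le_of_tendsto hS.abs (Eventually.of_forall hbd)

theorem hasSum_fourierSin_tail (n : ℕ) (φ : L2) :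
    HasSum (fun j : ℕ => √2 * (fourierSin (j + n + 1) φ / ((j + n + 1 : ℕ) : ℝ) ^ (0 + 1)))
      (fourierConst (volterraLin 1 φ) - Real.pi * fourierConst φ -
        ∑ j ∈ Finset.range n, √2 * (fourierSin (j + 1) φ / (j + 1 : ℕ))) := by
  refine hasSum_of_eq ((hasSum_nat_add_iff' n).mpr (hasSum_fourierConst_volterraLin_one φ))
    (fun j => ?_) rfl
  rw [zero_add, pow_one]

theorem hasSum_fourierCos_tail (n : ℕ) (φ : L2) :
    HasSum (fun j : ℕ => √2 * (fourierCos (j + n + 1) φ / ((j + n + 1 : ℕ) : ℝ) ^ (1 + 1)))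
      (fourierConst (volterraLin 1 (volterraLin 1 φ)) -
        Real.pi * fourierConst (volterraLin 1 φ) -
        ∑ j ∈ Finset.range n, √2 * (fourierSin (j + 1) (volterraLin 1 φ) / (j + 1 : ℕ)) +
        2 * fourierConst φ * tailSq n) := by
  refine hasSum_of_eq ((hasSum_fourierSin_tail n (volterraLin 1 φ)).add
    ((hasSum_tailSq n).mul_left (2 * fourierConst φ))) (fun j => ?_) rfl
  have hs2 : (√2 : ℝ) ^ 2 = 2 := Real.sq_sqrt (by norm_num)
  rw [fourierSin_volterraLin_one (by omega)]
  have hk : ((j + n + 1 : ℕ) : ℝ) ≠ 0 := by positivity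
  generalize ((j + n + 1 : ℕ) : ℝ) = k at *
  field_simp
  linear_combination (fourierConst φ * k ^ 3) * hs2

theorem hasSum_neg_fourierSin_tail (n : ℕ) (φ : L2) :
    HasSum (fun j : ℕ => √2 * (-fourierSin (j + n + 1) φ / ((j + n + 1 : ℕ) : ℝ) ^ (2 + 1)))
      (fourierConst (volterraLin 1 (volterraLin 1 (volterraLin 1 φ))) -
        Real.pi * fourierConst (volterraLin 1 (volterraLin 1 φ)) -
        ∑ j ∈ Finset.range n,
          √2 * (fourierSin (j + 1) (volterraLin 1 (volterraLin 1 φ)) / (j + 1 : ℕ)) +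
        2 * fourierConst (volterraLin 1 φ) * tailSq n) := by
  refine hasSum_of_eq (hasSum_fourierCos_tail n (volterraLin 1 φ)) (fun j => ?_) rfl
  rw [fourierCos_volterraLin_one (by omega)]
  field_simp
  ring

theorem sum_sq_fourierSin_tail_le (n : ℕ) (φ : L2) (s : Finset ℕ) :
    ∑ j ∈ s, fourierSin (j + n + 1) φ ^ 2 ≤ ‖φ - proj n φ‖ ^ 2 :=
  (Finset.sum_le_sum fun j _ => by simpa using sq_nonneg (fourierCos (j + n + 1) φ)).trans
    (sum_le_hasSum s (fun _ _ => by positivity) (hasSum_sq_fourier_tail n φ))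

theorem sum_sq_fourierCos_tail_le (n : ℕ) (φ : L2) (s : Finset ℕ) :
    ∑ j ∈ s, fourierCos (j + n + 1) φ ^ 2 ≤ ‖φ - proj n φ‖ ^ 2 :=
  (Finset.sum_le_sum fun j _ => by simpa using sq_nonneg (fourierSin (j + n + 1) φ)).trans
    (sum_le_hasSum s (fun _ _ => by positivity) (hasSum_sq_fourier_tail n φ))

/-! ### Low frequencies -/

theorem fourierSin_eq_of_volterraLin_one {k : ℕ} (hk : k ≠ 0) (φ : L2) :
    fourierSin k φ = -(k * fourierCos k (volterraLin 1 φ)) := by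
  rw [fourierCos_volterraLin_one hk]
  field_simp

theorem fourierCos_eq_of_volterraLin_one {k : ℕ} (hk : k ≠ 0) (φ : L2) :
    fourierCos k φ = k * fourierSin k (volterraLin 1 φ) + √2 * fourierConst φ := by
  rw [fourierSin_volterraLin_one hk]
  field_simp
  ring

theorem sum_range_fourierSin_eq {n : ℕ} {φ : L2} {e : ℝ}
    (h : ∀ k, 1 ≤ k → k ≤ n → fourierSin k φ = -(k * (√2 * e))) :
    ∑ j ∈ Finset.range n, √2 * (fourierSin (j + 1) φ / (j + 1 : ℕ)) = -(2 * n * e) := by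
  have hs2 : (√2 : ℝ) ^ 2 = 2 := Real.sq_sqrt (by norm_num)
  rw [Finset.sum_congr rfl (g := fun _ => -(2 * e)), Finset.sum_const, Finset.card_range,
    nsmul_eq_mul]
  · ring
  · intro j hj
    rw [h (j + 1) (by omega) (by simpa using hj)]
    field_simp
    rw [hs2]
    ring

theorem norm_sq_proj_le {n : ℕ} {φ : L2} {M : ℝ} (h0 : fourierConst φ ^ 2 ≤ M)
    (h : ∀ k, 1 ≤ k → k ≤ n → fourierCos k φ ^ 2 + fourierSin k φ ^ 2 ≤ 2 * M) :
    ‖proj n φ‖ ^ 2 ≤ (2 * n + 1) * M := by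
  rw [norm_sq_proj]
  have := Finset.sum_le_card_nsmul (Finset.range n)
    (fun j => fourierCos (j + 1) φ ^ 2 + fourierSin (j + 1) φ ^ 2) (2 * M)
    (fun j hj => h (j + 1) (by omega) (by simpa using hj))
  rw [Finset.card_range, nsmul_eq_mul] at this
  linarith

theorem fourier_eq_zero_of_projTo_eq_zero {n : ℕ} {φ : L2} (h : projTo n φ = 0) :
    fourierConst φ = 0 ∧ ∀ k, 1 ≤ k → k ≤ n → fourierCos k φ = 0 ∧ fourierSin k φ = 0 := by
  refine fourier_eq_zero_of_mem_orthogonal ?_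
  have h2 := sub_proj_mem_orthogonal n φ
  have h3 : proj n φ = 0 := by simp [proj, h]
  rwa [h3, sub_zero] at h2

/-! ### Stability of the Galerkin operators -/

theorem abs_le_of_two_equations {s D c C e₁ e₂ : ℝ} (hs : 0 ≤ s) (hs4 : s ≤ 4)
    (h₁ : |e₁| ≤ D) (h₂ : |e₂| ≤ 2 * D) (hC : C = Real.pi * c + e₁)
    (hc : s * c - Real.pi * C = e₂) : |c| ≤ D ∧ |C| ≤ 4.2 * D := by
  have hp1 := Real.pi_gt_d2
  have hp2 := Real.pi_lt_d2
  have hD : 0 ≤ D := (abs_nonneg _).trans h₁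
  have key : |c| * (Real.pi ^ 2 - s) ≤ 2 * D + 3.15 * D := by
    have e : -(c * (Real.pi ^ 2 - s)) = e₂ + Real.pi * e₁ := by rw [← hc, hC]; ring
    have hpos : 0 ≤ Real.pi ^ 2 - s := by nlinarith
    rw [← abs_of_nonneg hpos, ← abs_mul, ← abs_neg, e]
    refine (abs_add_le _ _).trans (add_le_add h₂ ?_)
    rw [abs_mul, abs_of_pos Real.pi_pos]
    exact mul_le_mul hp2.le h₁ (abs_nonneg _) (by norm_num)
  have hc' : |c| ≤ D := by
    have h := mul_le_mul_of_nonneg_left (show 5.85 ≤ Real.pi ^ 2 - s by nlinarith) (abs_nonneg c)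
    linarith
  refine ⟨hc', ?_⟩
  rw [hC]
  refine (abs_add_le _ _).trans ?_
  rw [abs_mul, abs_of_pos Real.pi_pos]
  nlinarith [abs_nonneg c]

theorem abs_le_of_three_equations {s D c C₁ C₂ e₁ e₂ e₃ : ℝ} (hs : 0 ≤ s) (hs4 : s ≤ 4)
    (h₁ : |e₁| ≤ D) (h₂ : |e₂| ≤ 2 * D) (h₃ : |e₃| ≤ 4 * D) (hC₁ : C₁ = Real.pi * c + e₁)
    (hC₂ : C₂ = Real.pi * C₁ - s * c + e₂) (hc : s * C₁ - Real.pi * C₂ = e₃) :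
    |c| ≤ 3 * D ∧ |C₁| ≤ 8 * D ∧ |C₂| ≤ 12 * D := by
  have hp1 := Real.pi_gt_d2
  have hp2 := Real.pi_lt_d2
  have hD : 0 ≤ D := (abs_nonneg _).trans h₁
  have hC₁' : |C₁| ≤ 8 * D := by
    have e : C₁ * (Real.pi ^ 2 - 2 * s) = -e₃ - s * e₁ - Real.pi * e₂ := by
      rw [← hc, hC₂]
      linear_combination -s * hC₁
    have hpos : 0 ≤ Real.pi ^ 2 - 2 * s := by nlinarith
    have hse : |s * e₁| ≤ 4 * D := by
      rw [abs_mul, abs_of_nonneg hs]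
      exact mul_le_mul hs4 h₁ (abs_nonneg _) (by norm_num)
    have hpe : |Real.pi * e₂| ≤ 3.15 * (2 * D) := by
      rw [abs_mul, abs_of_pos Real.pi_pos]
      exact mul_le_mul hp2.le h₂ (abs_nonneg _) (by norm_num)
    have key : |C₁| * (Real.pi ^ 2 - 2 * s) ≤ 14.3 * D := by
      rw [← abs_of_nonneg hpos, ← abs_mul, e]
      rw [abs_le] at *
      constructor <;> linarith [h₃.1, h₃.2, hse.1, hse.2, hpe.1, hpe.2]
    have h := mul_le_mul_of_nonneg_left (show 1.85 ≤ Real.pi ^ 2 - 2 * s by nlinarith)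
      (abs_nonneg C₁)
    linarith
  refine ⟨?_, hC₁', ?_⟩
  · have : |c| * Real.pi ≤ 9 * D := by
      rw [← abs_of_pos Real.pi_pos, ← abs_mul, show c * Real.pi = C₁ - e₁ by rw [hC₁]; ring]
      exact (abs_sub _ _).trans (by linarith)
    nlinarith [abs_nonneg c]
  · have : |C₂| * Real.pi ≤ 36 * D := by
      rw [← abs_of_pos Real.pi_pos, ← abs_mul,
        show C₂ * Real.pi = s * C₁ - e₃ by rw [← hc]; ring]
      refine (abs_sub _ _).trans ?_
      rw [abs_mul, abs_of_nonneg hs]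
      nlinarith [abs_nonneg C₁]
    nlinarith [abs_nonneg C₂]

theorem abs_mul_le_of_abs_mul_two_mul_add_one_le {k n : ℕ} (hk : k ≤ n) {c B : ℝ}
    (h : |(2 * n + 1) * c| ≤ B) : |k * c| ≤ B / 2 := by
  have hk' : (k : ℝ) ≤ n := by exact_mod_cast hk
  have h0 : (0 : ℝ) ≤ k := k.cast_nonneg
  rw [abs_mul, abs_of_nonneg (by positivity)] at h ⊢
  nlinarith [abs_nonneg c]

theorem norm_le_mul_of_sq_le {N u G D L M : ℝ} (hN : 0 < N) (hG : 0 ≤ G) (hL : 0 ≤ L)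
    (hD : D = 2 * G / √N) (hu : u ^ 2 ≤ N * M) (hM : 4 * M ≤ L ^ 2 * D ^ 2) :
    u ≤ L * G := by
  have hND : N * D ^ 2 = 4 * G ^ 2 := by
    rw [hD, div_pow, mul_pow, Real.sq_sqrt hN.le]
    field_simp
    ring
  refine (abs_le_of_sq_le_sq' (b := L * G) ?_ (by positivity)).2
  nlinarith

theorem two_mul_tailSq_mul_mem (n : ℕ) :
    0 ≤ 2 * tailSq n * (2 * n + 1) ∧ 2 * tailSq n * (2 * n + 1) ≤ 4 := by
  have hN : (0 : ℝ) < 2 * n + 1 := by positivity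
  have h0 := tailSq_nonneg n
  have h := tailSq_le n
  rw [le_div_iff₀ hN] at h
  exact ⟨by positivity, by linarith⟩

theorem abs_mul_le_of_abs_le_mul_div {N x B : ℝ} (hN : 0 < N) (h : |x| ≤ B * (2 / N)) :
    |N * x| ≤ 2 * B := by
  rw [abs_mul, abs_of_pos hN]
  calc N * |x| ≤ N * (B * (2 / N)) := by gcongr
    _ = 2 * B := by field_simp

theorem norm_proj_le_of_volterraLin_one {n : ℕ} {ψ : L2}
    (h : projTo n (volterraLin 1 ψ) = 0) : ‖proj n ψ‖ ≤ 1 * ‖ψ - proj n ψ‖ := by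
  obtain ⟨hc, hk⟩ := fourier_eq_zero_of_projTo_eq_zero h
  have hp1 := Real.pi_gt_d2
  have hs2 : (√2 : ℝ) ^ 2 = 2 := Real.sq_sqrt (by norm_num)
  have hsin : ∀ k, 1 ≤ k → k ≤ n → fourierSin k ψ = 0 := fun k h1 h2 => by
    rw [fourierSin_eq_of_volterraLin_one (by omega), (hk k h1 h2).1]
    simp
  have hb := abs_le_of_hasSum_tail (norm_nonneg _) (sum_sq_fourierSin_tail_le n ψ)
    (hasSum_fourierSin_tail n ψ)
  rw [sum_range_fourierSin_eq (e := 0) (fun k h1 h2 => by simp [hsin k h1 h2]), hc] at hb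
  set D := 2 * ‖ψ - proj n ψ‖ / √(2 * n + 1) with hD
  have hb' : Real.pi * |fourierConst ψ| ≤ D := by
    simpa [abs_mul, abs_of_pos Real.pi_pos] using hb
  refine norm_le_mul_of_sq_le (N := 2 * n + 1) (M := fourierConst ψ ^ 2) (by positivity)
    (norm_nonneg _) zero_le_one hD (norm_sq_proj_le le_rfl fun k h1 h2 => ?_) ?_
  · rw [hsin k h1 h2, fourierCos_eq_of_volterraLin_one (by omega), (hk k h1 h2).2, mul_zero,
      zero_add, mul_pow, hs2]
    simp
  · rw [← sq_abs (fourierConst ψ)]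
    have h2 : 2 * |fourierConst ψ| ≤ D := by nlinarith [abs_nonneg (fourierConst ψ)]
    have h3 := pow_le_pow_left₀ (by positivity) h2 2
    linarith

theorem norm_proj_le_of_volterraLin_two {n : ℕ} {ψ : L2}
    (h : projTo n (volterraLin 1 (volterraLin 1 ψ)) = 0) :
    ‖proj n ψ‖ ≤ 6 * ‖ψ - proj n ψ‖ := by
  obtain ⟨hc, hk⟩ := fourier_eq_zero_of_projTo_eq_zero h
  have hN : (0 : ℝ) < 2 * n + 1 := by positivity
  have hs2 : (√2 : ℝ) ^ 2 = 2 := Real.sq_sqrt (by norm_num)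
  have hsin1 : ∀ k, 1 ≤ k → k ≤ n → fourierSin k (volterraLin 1 ψ) = 0 := fun k h1 h2 => by
    rw [fourierSin_eq_of_volterraLin_one (by omega), (hk k h1 h2).1]
    simp
  set c₁ := fourierConst (volterraLin 1 ψ) with hc₁
  have hcos1 : ∀ k, 1 ≤ k → k ≤ n → fourierCos k (volterraLin 1 ψ) = √2 * c₁ :=
    fun k h1 h2 => by
      rw [fourierCos_eq_of_volterraLin_one (by omega), (hk k h1 h2).2, mul_zero, zero_add]
  have hsin : ∀ k, 1 ≤ k → k ≤ n → fourierSin k ψ = -(k * (√2 * c₁)) := fun k h1 h2 => by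
    rw [fourierSin_eq_of_volterraLin_one (by omega), hcos1 k h1 h2]
  set c₀ := fourierConst ψ with hc₀
  have hcos : ∀ k, 1 ≤ k → k ≤ n → fourierCos k ψ = √2 * c₀ := fun k h1 h2 => by
    rw [fourierCos_eq_of_volterraLin_one (by omega), hsin1 k h1 h2, mul_zero, zero_add]
  have hb1 := abs_le_of_hasSum_tail (norm_nonneg _) (sum_sq_fourierSin_tail_le n ψ)
    (hasSum_fourierSin_tail n ψ)
  have hb2 := abs_le_of_hasSum_tail (norm_nonneg _) (sum_sq_fourierCos_tail_le n ψ)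
    (hasSum_fourierCos_tail n ψ)
  rw [sum_range_fourierSin_eq hsin, pow_zero, mul_one] at hb1
  rw [sum_range_fourierSin_eq (e := 0) (fun k h1 h2 => by simp [hsin1 k h1 h2]), hc, pow_one]
    at hb2
  set D := 2 * ‖ψ - proj n ψ‖ / √(2 * n + 1) with hD
  obtain ⟨hs, hs4⟩ := two_mul_tailSq_mul_mem n
  have hb2' := abs_mul_le_of_abs_le_mul_div hN hb2
  obtain ⟨h0, h1⟩ := abs_le_of_two_equations (c := c₀) (C := (2 * n + 1) * c₁) hs hs4 hb1 hb2'
    (by ring) (by ring)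
  have hsq : ∀ k : ℕ, k ≤ n → c₀ ^ 2 + (k * c₁) ^ 2 ≤ 9 * D ^ 2 := fun k hkn => by
    have h2 := abs_mul_le_of_abs_mul_two_mul_add_one_le hkn h1
    have h3 := sq_le_sq' (abs_le.mp h0).1 (abs_le.mp h0).2
    have h4 := sq_le_sq' (abs_le.mp h2).1 (abs_le.mp h2).2
    nlinarith
  refine norm_le_mul_of_sq_le (N := 2 * n + 1) (M := 9 * D ^ 2) (by positivity)
    (norm_nonneg _) (by norm_num) hD (norm_sq_proj_le ?_ fun k h1 h2 => ?_) (by nlinarith)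
  · have := hsq 0 n.zero_le
    simpa using this
  · rw [hsin k h1 h2, hcos k h1 h2]
    linear_combination 2 * hsq k h2 + (c₀ ^ 2 + (k * c₁) ^ 2) * hs2

theorem norm_proj_le_of_volterraLin_three {n : ℕ} {ψ : L2}
    (h : projTo n (volterraLin 1 (volterraLin 1 (volterraLin 1 ψ))) = 0) :
    ‖proj n ψ‖ ≤ 49 * ‖ψ - proj n ψ‖ := by
  obtain ⟨hc, hk⟩ := fourier_eq_zero_of_projTo_eq_zero h
  have hN : (0 : ℝ) < 2 * n + 1 := by positivity
  have hs2 : (√2 : ℝ) ^ 2 = 2 := Real.sq_sqrt (by norm_num)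
  set f₂ := volterraLin 1 (volterraLin 1 ψ) with hf₂
  have hsin2 : ∀ k, 1 ≤ k → k ≤ n → fourierSin k f₂ = 0 := fun k h1 h2 => by
    rw [fourierSin_eq_of_volterraLin_one (by omega), (hk k h1 h2).1]
    simp
  set c₂ := fourierConst f₂ with hc₂
  have hcos2 : ∀ k, 1 ≤ k → k ≤ n → fourierCos k f₂ = √2 * c₂ := fun k h1 h2 => by
    rw [fourierCos_eq_of_volterraLin_one (by omega), (hk k h1 h2).2, mul_zero, zero_add]
  set c₁ := fourierConst (volterraLin 1 ψ) with hc₁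
  have hsin1 : ∀ k, 1 ≤ k → k ≤ n → fourierSin k (volterraLin 1 ψ) = -(k * (√2 * c₂)) :=
    fun k h1 h2 => by
      rw [fourierSin_eq_of_volterraLin_one (by omega), ← hf₂, hcos2 k h1 h2]
  have hcos1 : ∀ k, 1 ≤ k → k ≤ n → fourierCos k (volterraLin 1 ψ) = √2 * c₁ :=
    fun k h1 h2 => by
      rw [fourierCos_eq_of_volterraLin_one (by omega), ← hf₂, hsin2 k h1 h2, mul_zero, zero_add]
  have hsin : ∀ k, 1 ≤ k → k ≤ n → fourierSin k ψ = -(k * (√2 * c₁)) := fun k h1 h2 => by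
    rw [fourierSin_eq_of_volterraLin_one (by omega), hcos1 k h1 h2]
  set c₀ := fourierConst ψ with hc₀
  have hcos : ∀ k, 1 ≤ k → k ≤ n → fourierCos k ψ = √2 * (c₀ - k * (k * c₂)) :=
    fun k h1 h2 => by
      rw [fourierCos_eq_of_volterraLin_one (by omega), hsin1 k h1 h2]
      ring
  have hb1 := abs_le_of_hasSum_tail (norm_nonneg _) (sum_sq_fourierSin_tail_le n ψ)
    (hasSum_fourierSin_tail n ψ)
  have hb2 := abs_le_of_hasSum_tail (norm_nonneg _) (sum_sq_fourierCos_tail_le n ψ)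
    (hasSum_fourierCos_tail n ψ)
  have hb3 := abs_le_of_hasSum_tail (norm_nonneg _)
    (fun s => by simpa only [neg_sq] using sum_sq_fourierSin_tail_le n ψ s)
    (hasSum_neg_fourierSin_tail n ψ)
  rw [sum_range_fourierSin_eq hsin, pow_zero, mul_one] at hb1
  rw [sum_range_fourierSin_eq hsin1, pow_one, ← hf₂] at hb2
  rw [← hf₂, sum_range_fourierSin_eq (e := 0) (fun k h1 h2 => by simp [hsin2 k h1 h2]), hc,
    sq, ← mul_assoc] at hb3
  set D := 2 * ‖ψ - proj n ψ‖ / √(2 * n + 1) with hD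
  obtain ⟨hs, hs4⟩ := two_mul_tailSq_mul_mem n
  have hb2' := abs_mul_le_of_abs_le_mul_div hN hb2
  have hb3' := abs_mul_le_of_abs_le_mul_div hN
    (B := 2 * D) ((abs_mul_le_of_abs_le_mul_div hN hb3).trans_eq (by ring))
  obtain ⟨h0, h1, h2⟩ := abs_le_of_three_equations (c := c₀) (C₁ := (2 * n + 1) * c₁)
    (C₂ := (2 * n + 1) * ((2 * n + 1) * c₂)) hs hs4 hb1 hb2' (hb3'.trans_eq (by ring))
    (by ring) (by ring) (by ring)
  have hsq : ∀ k : ℕ, k ≤ n → (c₀ - k * (k * c₂)) ^ 2 + (k * c₁) ^ 2 ≤ 52 * D ^ 2 :=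
    fun k hkn => by
      have h3 := abs_mul_le_of_abs_mul_two_mul_add_one_le hkn h1
      have h4 := abs_mul_le_of_abs_mul_two_mul_add_one_le hkn h2
      rw [mul_left_comm] at h4
      have h5 := abs_mul_le_of_abs_mul_two_mul_add_one_le hkn h4
      have h6 : |c₀ - k * (k * c₂)| ≤ 6 * D := (abs_sub _ _).trans (by linarith)
      have h7 := sq_le_sq' (abs_le.mp h3).1 (abs_le.mp h3).2
      have h8 := sq_le_sq' (abs_le.mp h6).1 (abs_le.mp h6).2
      linarith
  refine norm_le_mul_of_sq_le (N := 2 * n + 1) (M := 52 * D ^ 2) (by positivity)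
    (norm_nonneg _) (by norm_num) hD (norm_sq_proj_le ?_ fun k h1 h2 => ?_) (by nlinarith)
  · have := hsq 0 n.zero_le
    simpa using this
  · rw [hsin k h1 h2, hcos k h1 h2]
    linear_combination 2 * hsq k h2 + ((c₀ - k * (k * c₂)) ^ 2 + (k * c₁) ^ 2) * hs2

theorem one_le_gamma (p : ℕ) : 1 ≤ gamma p := by
  unfold gamma kappa
  linarith [Real.sqrt_nonneg (∑ i, decayConst p i ^ 2)]

theorem one_add_abs_decayConst_le_gamma (p : ℕ) (i : Fin 6) : 1 + |decayConst p i| ≤ gamma p := by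
  unfold gamma kappa
  gcongr
  refine Real.le_sqrt_of_sq_le ?_
  rw [sq_abs]
  exact Finset.single_le_sum (f := fun i => decayConst p i ^ 2) (fun _ _ => sq_nonneg _)
    (Finset.mem_univ i)

/-- If `P_n A^(p) ψ = 0`, then `P_n ψ` is controlled by `(I - P_n) ψ`. -/
theorem norm_proj_le_gamma_mul {p n : ℕ} (hp₁ : 1 ≤ p) (hp₃ : p ≤ 3) {ψ : L2}
    (h : projTo n (volterraLin p ψ) = 0) : ‖proj n ψ‖ ≤ gamma p * ‖ψ - proj n ψ‖ := by
  rw [volterraLin_eq_iterate hp₁] at h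
  have hle : ∀ L : ℝ, L ≤ gamma p → L * ‖ψ - proj n ψ‖ ≤ gamma p * ‖ψ - proj n ψ‖ :=
    fun L hL => mul_le_mul_of_nonneg_right hL (norm_nonneg _)
  interval_cases p
  · exact (norm_proj_le_of_volterraLin_one h).trans (hle _ (one_le_gamma 1))
  · refine (norm_proj_le_of_volterraLin_two h).trans (hle _ ?_)
    have := one_add_abs_decayConst_le_gamma 2 5
    rw [show decayConst 2 5 = 5 from rfl] at this
    norm_num at this
    exact this
  · refine (norm_proj_le_of_volterraLin_three h).trans (hle _ ?_)
    have := one_add_abs_decayConst_le_gamma 3 5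
    rw [show decayConst 3 5 = 48 from rfl] at this
    norm_num at this
    exact this

theorem proj_coe {n : ℕ} (u : trigSpace n) : proj n (u : L2) = u :=
  Submodule.starProjection_eq_self_iff.mpr u.2

theorem galerkinOp_apply (p n : ℕ) (u : trigSpace n) :
    galerkinOp p n u = projTo n (volterraLin p (u : L2)) := by
  have h : galerkinOp p n u = projTo n (volterraLin p (proj n (u : L2))) := rfl
  rw [h, proj_coe]

theorem galerkinOp_injective {p : ℕ} (hp₁ : 1 ≤ p) (hp₃ : p ≤ 3) (n : ℕ) :
    Function.Injective (galerkinOp p n) := by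
  refine (injective_iff_map_eq_zero _).mpr fun u hu => ?_
  rw [galerkinOp_apply] at hu
  have h := norm_proj_le_gamma_mul hp₁ hp₃ hu
  rw [proj_coe, sub_self, norm_zero, mul_zero] at h
  exact Subtype.ext (norm_le_zero_iff.mp h)

theorem galerkinOp_surjective {p : ℕ} (hp₁ : 1 ≤ p) (hp₃ : p ≤ 3) (n : ℕ) :
    Function.Surjective (galerkinOp p n) :=
  LinearMap.injective_iff_surjective (f := (galerkinOp p n : trigSpace n →ₗ[ℝ] trigSpace n)).mp
    (galerkinOp_injective hp₁ hp₃ n)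

theorem apply_moorePenrose_of_surjective {X Y : Type*} [NormedAddCommGroup X]
    [InnerProductSpace ℝ X] [NormedAddCommGroup Y] [InnerProductSpace ℝ Y]
    [FiniteDimensional ℝ X] {A : X →L[ℝ] Y} (hA : Function.Surjective A) (y : Y) :
    A (moorePenrose A y) = y := by
  obtain ⟨x, hx⟩ := hA y
  have h := (moorePenrose_spec A y).1 x
  rw [hx, sub_self, norm_zero] at h
  exact sub_eq_zero.mp (norm_le_zero_iff.mp h)

theorem projTo_volterraLin_galerkinApprox {p : ℕ} (hp₁ : 1 ≤ p) (hp₃ : p ≤ 3) (n : ℕ) (y : L2) :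
    projTo n (volterraLin p (galerkinApprox p n y)) = projTo n y := by
  rw [galerkinApprox, ← galerkinOp_apply]
  exact apply_moorePenrose_of_surjective (galerkinOp_surjective hp₁ hp₃ n) _

theorem norm_galerkinApprox_volterraLin_sub_le {p : ℕ} (hp₁ : 1 ≤ p) (hp₃ : p ≤ 3) (n : ℕ)
    (φ : L2) : ‖galerkinApprox p n (volterraLin p φ) - φ‖ ≤
      (gamma p + 1) * ‖φ - proj n φ‖ := by
  set w := galerkinApprox p n (volterraLin p φ) with hw
  have h0 : projTo n (volterraLin p (w - φ)) = 0 := by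
    rw [map_sub, map_sub, projTo_volterraLin_galerkinApprox hp₁ hp₃, sub_self]
  have h := norm_proj_le_gamma_mul hp₁ hp₃ h0
  have hpw : proj n w = w := proj_coe _
  have e : w - φ - proj n (w - φ) = -(φ - proj n φ) := by
    rw [map_sub, hpw]
    abel
  rw [e, norm_neg] at h
  calc ‖w - φ‖ = ‖proj n (w - φ) + (w - φ - proj n (w - φ))‖ := by rw [add_sub_cancel]
    _ ≤ ‖proj n (w - φ)‖ + ‖w - φ - proj n (w - φ)‖ := norm_add_le _ _
    _ ≤ (gamma p + 1) * ‖φ - proj n φ‖ := by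
      rw [e, norm_neg]
      linarith

end TrigGalerkin

end

theorem corollary5p1 (p : ℕ) (hp₁ : 1 ≤ p) (hp₃ : p ≤ 3)
    (y : TrigGalerkin.L2) (hy : TrigGalerkin.MemH0 p y)
    (yp : TrigGalerkin.L2) (hyp : TrigGalerkin.HasWeakDeriv p y yp) :
    (∀ n : ℕ, 1 ≤ n → ‖TrigGalerkin.galerkinApprox p n y - yp‖ ≤
        (TrigGalerkin.gamma p + 1) * ‖yp - TrigGalerkin.proj n yp‖) ∧
    Tendsto (fun n : ℕ => (TrigGalerkin.gamma p + 1) * ‖yp - TrigGalerkin.proj n yp‖)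
      atTop (𝓝 0) ∧
    Tendsto (fun n : ℕ => ‖TrigGalerkin.galerkinApprox p n y - yp‖) atTop (𝓝 0) ∧
    ∀ l : ℝ, 0 < l → TrigGalerkin.MemHper l yp → ∀ n : ℕ, 1 ≤ n →
      ‖TrigGalerkin.galerkinApprox p n y - yp‖ ≤
        (TrigGalerkin.gamma p + 1) / (n : ℝ) ^ l * TrigGalerkin.hperNorm l yp := by
  have hbound : ∀ n : ℕ, ‖TrigGalerkin.galerkinApprox p n y - yp‖ ≤
      (TrigGalerkin.gamma p + 1) * ‖yp - TrigGalerkin.proj n yp‖ := fun n => by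
    rw [hy.eq_volterraLin hp₁ hyp]
    exact TrigGalerkin.norm_galerkinApprox_volterraLin_sub_le hp₁ hp₃ n yp
  have hlim : Tendsto (fun n : ℕ => (TrigGalerkin.gamma p + 1) *
      ‖yp - TrigGalerkin.proj n yp‖) atTop (𝓝 0) := by
    simpa using (TrigGalerkin.tendsto_norm_sub_proj yp).const_mul (TrigGalerkin.gamma p + 1)
  refine ⟨fun n _ => hbound n, hlim,
    squeeze_zero (fun _ => norm_nonneg _) hbound hlim, fun l hl hper n hn => ?_⟩
  refine (hbound n).trans ?_
  have hγ := TrigGalerkin.one_le_gamma p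
  have h := mul_le_mul_of_nonneg_left (TrigGalerkin.norm_sub_proj_le hl hper hn)
    (by linarith : 0 ≤ TrigGalerkin.gamma p + 1)
  rwa [← mul_assoc, mul_one_div] at h
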